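/- Let $N$ be a positive integer, let $1<p<N$ and $0<\beta<\left(\frac{N-p}{p}\right)^p$, and let $\Omega\subset\mathbb{R}^N$ be a bounded open set. Let $W^{1,p}_0(\Omega)$ be the closure of $C_c^\infty(\Omega)$ in $W^{1,p}(\Omega)$, with $\|u\|_{W^{1,p}_0(\Omega)}=\left(\int_\Omega|\nabla u|^p\,dx\right)^{1/p}$ ($|\cdot|$ the Euclidean norm), let $W^{-1,p'}(\Omega)$ be its dual, where $p'=p/(p-1)$, and let $$\|f\|_{W^{-1,p'}(\Omega)}=\sup\{|\langle f,v\rangle| : v\in W^{1,p}_0(\Omega),\ \|v\|_{W^{1,p}_0(\Omega)}\le 1\}.$$ Then for every $f\in W^{-1,p'}(\Omega)$ the problem $$-\Delta_p u=\frac{\beta}{|x|^p}|u|^{p-2}u+f\ \text{ in }\Omega,\qquad u=0\ \text{ on }\partial\Omega,$$ has a weak solution $u_p$, that is, there is $u_p\in W^{1,p}_0(\Omega)$ such that for all $\varphi\in W^{1,p}_0(\Omega)$ the two integrals below converge absolutely and $$\int_\Omega|\nabla u_p|^{p-2}\nabla u_p\cdot\nabla\varphi\,dx=\beta\int_\Omega\frac{1}{|x|^p}|u_p|^{p-2}u_p\,\varphi\,dx+\langle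 f,\varphi\rangle ,$$ and this solution satisfies $$\|u_p\|_{W^{1,p}_0(\Omega)}\le\left[\frac{\|f\|_{W^{-1,p'}(\Omega)}}{1-\beta\left(\frac{p}{N-p}\right)^p}\right]^{\frac1{p-1}}.$$ -/

import Mathlib

open MeasureTheory
open scoped ContDiff ENNReal

namespace HardyPLaplace

instance factOneLeOfReal (p : ℝ) [hp : Fact (1 < p)] : Fact (1 ≤ ENNReal.ofReal p) :=
  ⟨by simpa using ENNReal.ofReal_le_ofReal hp.out.le⟩

/-- Points of `ℝ^N`, with the Euclidean norm. -/
abbrev Space (N : ℕ) : Type := EuclideanSpace ℝ (Fin N)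

/-- `φ ∈ C_c^∞(Ω)`. -/
structure IsTestFunction {N : ℕ} (Ω : Set (Space N)) (φ : Space N → ℝ) : Prop where
  smooth : ContDiff ℝ ∞ φ
  compact : HasCompactSupport φ
  support_subset : tsupport φ ⊆ Ω

/-- The Lebesgue space `L^p(Ω; F)`. -/
abbrev LpOn {N : ℕ} (Ω : Set (Space N)) (p : ℝ) (F : Type) [NormedAddCommGroup F] : Type :=
  Lp F (ENNReal.ofReal p) ((volume : Measure (Space N)).restrict Ω)

/-- `g` is the weak gradient of `u` in `Ω`:
`∫_Ω u ∂_v φ dx = - ∫_Ω φ (v · g) dx` for all `φ ∈ C_c^∞(Ω)` and all directions `v`. -/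
def IsWeakGradient {N : ℕ} (Ω : Set (Space N)) (u : Space N → ℝ) (g : Space N → Space N) : Prop :=
  ∀ φ : Space N → ℝ, IsTestFunction Ω φ → ∀ v : Space N,
    ∫ x in Ω, u x * fderiv ℝ φ x v = - ∫ x in Ω, φ x * inner ℝ v (g x)

theorem integrable_lp_mul {N : ℕ} {Ω : Set (Space N)} {p : ℝ} [Fact (1 < p)]
    (u : LpOn Ω p ℝ) {ψ : Space N → ℝ} (hc : Continuous ψ) (hs : HasCompactSupport ψ) :
    Integrable (fun x => u x * ψ x) (volume.restrict Ω) := by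
  have h := ((Lp.memLp u).locallyIntegrable
    (Fact.out : 1 ≤ ENNReal.ofReal p)).integrable_smul_left_of_hasCompactSupport hc hs
  simpa [mul_comm] using h

theorem integrable_mul_inner_lp {N : ℕ} {Ω : Set (Space N)} {p : ℝ} [Fact (1 < p)]
    (g : LpOn Ω p (Space N)) {ψ : Space N → ℝ} (hc : Continuous ψ) (hs : HasCompactSupport ψ)
    (v : Space N) :
    Integrable (fun x => ψ x * inner ℝ v (g x)) (volume.restrict Ω) := by
  have h := ((Lp.memLp g).locallyIntegrable
    (Fact.out : 1 ≤ ENNReal.ofReal p)).integrable_smul_left_of_hasCompactSupport hc hs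
  simpa [inner_smul_right] using h.const_inner (𝕜 := ℝ) v

theorem IsTestFunction.fderiv_continuous {N : ℕ} {Ω : Set (Space N)} {φ : Space N → ℝ}
    (h : IsTestFunction Ω φ) (v : Space N) : Continuous (fun x => fderiv ℝ φ x v) :=
  (h.smooth.continuous_fderiv (by simp)).clm_apply continuous_const

theorem IsTestFunction.fderiv_compact {N : ℕ} {Ω : Set (Space N)} {φ : Space N → ℝ}
    (h : IsTestFunction Ω φ) (v : Space N) : HasCompactSupport (fun x => fderiv ℝ φ x v) :=
  h.compact.fderiv_apply (𝕜 := ℝ) v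

/-- The Sobolev space `W^{1,p}(Ω)`. The (unique) weak gradient is carried along: an element is a
pair `(u, ∇u)` with `u ∈ L^p(Ω)` and `∇u ∈ L^p(Ω; ℝ^N)`, and the topology is that of the norm
of `W^{1,p}(Ω)`. -/
def sobolev {N : ℕ} (Ω : Set (Space N)) (p : ℝ) [Fact (1 < p)] :
    Submodule ℝ (LpOn Ω p ℝ × LpOn Ω p (Space N)) where
  carrier := {w | IsWeakGradient Ω w.1 w.2}
  zero_mem' := by
    intro φ hφ v
    have h1 : ∫ x in Ω, (0 : LpOn Ω p ℝ) x * fderiv ℝ φ x v = 0 := by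
      apply integral_eq_zero_of_ae
      filter_upwards [Lp.coeFn_zero ℝ (ENNReal.ofReal p) (volume.restrict Ω)] with x hx
      rw [hx]; simp
    have h2 : ∫ x in Ω, φ x * inner ℝ v ((0 : LpOn Ω p (Space N)) x) = 0 := by
      apply integral_eq_zero_of_ae
      filter_upwards [Lp.coeFn_zero (Space N) (ENNReal.ofReal p) (volume.restrict Ω)] with x hx
      rw [hx]; simp
    exact h1.trans (by rw [← neg_zero]; exact congrArg _ h2.symm)
  add_mem' := by
    intro a b ha hb φ hφ v
    have h1 : ∫ x in Ω, (a.1 + b.1) x * fderiv ℝ φ x v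
        = ∫ x in Ω, (a.1 x * fderiv ℝ φ x v + b.1 x * fderiv ℝ φ x v) := by
      apply integral_congr_ae
      filter_upwards [Lp.coeFn_add a.1 b.1] with x hx
      rw [hx, Pi.add_apply, add_mul]
    have h2 : ∫ x in Ω, φ x * inner ℝ v ((a.2 + b.2) x)
        = ∫ x in Ω, (φ x * inner ℝ v (a.2 x) + φ x * inner ℝ v (b.2 x)) := by
      apply integral_congr_ae
      filter_upwards [Lp.coeFn_add a.2 b.2] with x hx
      rw [hx, Pi.add_apply, inner_add_right, mul_add]
    have hv := hφ.fderiv_continuous v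
    have hw := hφ.fderiv_compact v
    rw [integral_add (integrable_lp_mul _ hv hw) (integrable_lp_mul _ hv hw)] at h1
    rw [integral_add (integrable_mul_inner_lp _ hφ.smooth.continuous hφ.compact v)
      (integrable_mul_inner_lp _ hφ.smooth.continuous hφ.compact v)] at h2
    have ha' := ha φ hφ v
    have hb' := hb φ hφ v
    change ∫ x in Ω, (a.1 + b.1) x * fderiv ℝ φ x v
      = - ∫ x in Ω, φ x * inner ℝ v ((a.2 + b.2) x)
    rw [h1, h2, ha', hb']
    ring
  smul_mem' := by
    intro c a ha φ hφ v
    have h1 : ∫ x in Ω, (c • a.1) x * fderiv ℝ φ x v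
        = ∫ x in Ω, c * (a.1 x * fderiv ℝ φ x v) := by
      apply integral_congr_ae
      filter_upwards [Lp.coeFn_smul c a.1] with x hx
      simp [hx, mul_assoc]
    have h2 : ∫ x in Ω, φ x * inner ℝ v ((c • a.2) x)
        = ∫ x in Ω, c * (φ x * inner ℝ v (a.2 x)) := by
      apply integral_congr_ae
      filter_upwards [Lp.coeFn_smul c a.2] with x hx
      simp [hx, inner_smul_right]
      ring
    have ha' := ha φ hφ v
    change ∫ x in Ω, (c • a.1) x * fderiv ℝ φ x v
      = - ∫ x in Ω, φ x * inner ℝ v ((c • a.2) x)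
    rw [h1, h2, integral_const_mul, integral_const_mul, ha']
    ring

/-- The copy of `C_c^∞(Ω)` in `L^p × L^p`: all pairs `(φ, ∇φ)` with `φ ∈ C_c^∞(Ω)`.
(This set is a linear subspace; the span only packages it as one.) -/
noncomputable def testPairs {N : ℕ} (Ω : Set (Space N)) (p : ℝ) [Fact (1 < p)] :
    Submodule ℝ (LpOn Ω p ℝ × LpOn Ω p (Space N)) :=
  Submodule.span ℝ {w | ∃ φ : Space N → ℝ, IsTestFunction Ω φ ∧
    w.1 =ᵐ[volume.restrict Ω] φ ∧ w.2 =ᵐ[volume.restrict Ω] gradient φ}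

/-- `W_0^{1,p}(Ω)`: the closure of `C_c^∞(Ω)` in `W^{1,p}(Ω)`. -/
noncomputable def sobolevZero {N : ℕ} (Ω : Set (Space N)) (p : ℝ) [Fact (1 < p)] :
    Submodule ℝ (LpOn Ω p ℝ × LpOn Ω p (Space N)) :=
  sobolev Ω p ⊓ (testPairs Ω p).topologicalClosure

variable {N : ℕ} {Ω : Set (Space N)} {p : ℝ} [Fact (1 < p)]

/-- The function underlying an element of `W_0^{1,p}(Ω)`. -/
def fn (u : sobolevZero Ω p) : LpOn Ω p ℝ := u.1.1

/-- The weak gradient of an element of `W_0^{1,p}(Ω)`. -/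
def grad (u : sobolevZero Ω p) : LpOn Ω p (Space N) := u.1.2

/-- `‖u‖_{W_0^{1,p}(Ω)} = ‖∇u‖_{L^p(Ω)}`. -/
noncomputable def normZero (u : sobolevZero Ω p) : ℝ := ‖grad u‖

/-- The norm of `f ∈ W^{-1,p'}(Ω)`, dual to the norm `‖∇u‖_{L^p(Ω)}` of `W_0^{1,p}(Ω)`. -/
noncomputable def dualNorm (f : StrongDual ℝ (sobolevZero Ω p)) : ℝ :=
  sSup {t | ∃ v : sobolevZero Ω p, normZero v ≤ 1 ∧ t = |f v|}

/-- `u ∈ W_0^{1,p}(Ω)` is a weak solution of `-Δ_p u = β |u|^{p-2} u / |x|^p + f` in `Ω`, `u = 0`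
on `∂Ω`: for all `φ ∈ W_0^{1,p}(Ω)` both integrals converge absolutely and
`∫_Ω |∇u|^{p-2} ∇u · ∇φ dx = β ∫_Ω |x|^{-p} |u|^{p-2} u φ dx + ⟨f, φ⟩`. -/
def IsWeakSolution (β : ℝ) (f : StrongDual ℝ (sobolevZero Ω p)) (u : sobolevZero Ω p) : Prop :=
  ∀ φ : sobolevZero Ω p,
    IntegrableOn (fun x => ‖grad u x‖ ^ (p - 2) * inner ℝ (grad u x) (grad φ x)) Ω ∧
    IntegrableOn (fun x => 1 / ‖x‖ ^ p * (|fn u x| ^ (p - 2) * fn u x * fn φ x)) Ω ∧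
    ∫ x in Ω, ‖grad u x‖ ^ (p - 2) * inner ℝ (grad u x) (grad φ x)
      = β * (∫ x in Ω, 1 / ‖x‖ ^ p * (|fn u x| ^ (p - 2) * fn u x * fn φ x)) + f φ

end HardyPLaplace

/-! The solution is a minimizer of the energy `‖∇u‖^p - β ∫ |u|^p / |x|^p - p ⟨f, u⟩`, obtained by
the direct method. The difficulty is lower semicontinuity: the Hardy term enters with a minus sign
and is not weakly continuous, because the embedding into the weighted space is not compact at the
origin.

The way out is to write the Hardy deficit as an integral of a nonnegative density. Put `a = (N - p)
/ p`. Integrating the divergence of `|u|^p |x|^{-p} x` gives zero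
(`integral_density_euler_eq_zero`); adding `a^{p-1}` times this to `‖∇u‖^p - a^p ∫ |u|^p / |x|^p`
yields `∫ hardyDensity` (`integral_hardyDensity`). By Young's inequality this density is pointwise
nonnegative, which is Hardy's inequality, and it is convex in `∇u` for fixed `u`. With `θ = β / a^p
< 1` the energy is `(1 - θ) ‖∇u‖^p + θ ∫ hardyDensity - p ⟨f, u⟩` (`energy_eq`), which is coercive.

For semicontinuity the density is cut off near the origin, which only decreases it and makes its
coefficients bounded. A bounded sequence has a subsequence converging strongly in `L^p`
(`isCompactOperator_fnL`), so `u` may be frozen at the limit, leaving a continuous convex functional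
of the gradient. Convex combinations of tails, convergent by uniform convexity of `L^p`, play the
role of weak limits (`exists_weak_limit`). Letting the cut-off shrink gives
`energy_le_of_weak_limit`.

Differentiating the energy at a minimizer gives the equation; testing it with `u` and using Hardy's
inequality gives the bound. -/

namespace HardyPLaplace

/-! ### Pointwise inequalities for `p`-homogeneous expressions. -/

section Pointwise

/-- By homogeneity it suffices to argue on the unit sphere. There the set where `G ≥ δ` is compact
and `H` is positive on it, hence bounded below, so a large multiple of `H` absorbs `G`. This single
compactness argument supplies both uniform convexity and continuity estimates for all `p > 1`,
without explicit constants. -/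
theorem exists_le_mul_rpow_norm_add_mul {V : Type*} [NormedAddCommGroup V] [NormedSpace ℝ V]
    [FiniteDimensional ℝ V] {p : ℝ} (hp : 0 < p) {G H : V → ℝ}
    (hG : Continuous G) (hH : Continuous H)
    (hGh : ∀ t : ℝ, 0 < t → ∀ z, G (t • z) = t ^ p * G z)
    (hHh : ∀ t : ℝ, 0 < t → ∀ z, H (t • z) = t ^ p * H z)
    (hH0 : ∀ z, 0 ≤ H z) (hGH : ∀ z, H z = 0 → G z ≤ 0) {δ : ℝ} (hδ : 0 < δ) :
    ∃ C : ℝ, 0 ≤ C ∧ ∀ z, G z ≤ δ * ‖z‖ ^ p + C * H z := by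
  have key : ∃ C : ℝ, 0 ≤ C ∧ ∀ z, ‖z‖ = 1 → G z ≤ δ + C * H z := by
    have hK : IsCompact (Metric.sphere (0 : V) 1 ∩ {z | δ ≤ G z}) :=
      (isCompact_sphere 0 1).inter_right (isClosed_le continuous_const hG)
    have hpos : ∀ z ∈ Metric.sphere (0 : V) 1 ∩ {z | δ ≤ G z}, 0 < H z := by
      rintro z ⟨-, hz⟩
      refine lt_of_le_of_ne (hH0 z) fun h => ?_
      have := hGH z h.symm
      simp only [Set.mem_ofPred_eq] at hz
      linarith
    obtain ⟨c, hc, hcH⟩ : ∃ c : ℝ, 0 < c ∧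
        ∀ z ∈ Metric.sphere (0 : V) 1 ∩ {z | δ ≤ G z}, c ≤ H z := by
      rcases (Metric.sphere (0 : V) 1 ∩ {z | δ ≤ G z}).eq_empty_or_nonempty with he | hne
      · exact ⟨1, one_pos, by simp [he]⟩
      · obtain ⟨z, hz, hmin⟩ := hK.exists_isMinOn hne hH.continuousOn
        exact ⟨H z, hpos z hz, fun y hy => hmin hy⟩
    obtain ⟨M, hM⟩ := (isCompact_sphere (0 : V) 1).bddAbove_image hG.continuousOn
    refine ⟨|M| / c, by positivity, fun z hz => ?_⟩
    have hzs : z ∈ Metric.sphere (0 : V) 1 := by simpa using hz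
    by_cases h : δ ≤ G z
    · have h1 := hcH z ⟨hzs, h⟩
      have h2 : G z ≤ M := hM ⟨z, hzs, rfl⟩
      have h3 : |M| ≤ |M| / c * H z := by
        rw [div_mul_eq_mul_div, le_div_iff₀ hc]
        gcongr
      linarith [le_abs_self M]
    · have : 0 ≤ |M| / c * H z := mul_nonneg (by positivity) (hH0 z)
      linarith
  obtain ⟨C, hC, hCG⟩ := key
  refine ⟨C, hC, fun z => ?_⟩
  rcases eq_or_ne z 0 with rfl | hz
  · have h := hGh 2 two_pos 0
    have h2 : (1 : ℝ) < 2 ^ p := Real.one_lt_rpow one_lt_two hp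
    have h3 : G 0 = 0 := by
      rw [smul_zero] at h
      nlinarith
    rw [h3]
    have := mul_nonneg hC (hH0 0)
    positivity
  · have hz' : 0 < ‖z‖ := norm_pos_iff.2 hz
    have h1 := hCG (‖z‖⁻¹ • z) (by rw [norm_smul, norm_inv, norm_norm, inv_mul_cancel₀ hz'.ne'])
    rw [hGh _ (by positivity), hHh _ (by positivity), Real.inv_rpow hz'.le] at h1
    have h4 : 0 < ‖z‖ ^ p := by positivity
    have := mul_le_mul_of_nonneg_left h1 h4.le
    field_simp at this
    linarith

theorem norm_prod_rpow_le {V W : Type*} [NormedAddCommGroup V] [NormedAddCommGroup W]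
    {p : ℝ} (z : V × W) : ‖z‖ ^ p ≤ ‖z.1‖ ^ p + ‖z.2‖ ^ p := by
  have h1 : 0 ≤ ‖z.1‖ ^ p := by positivity
  have h2 : 0 ≤ ‖z.2‖ ^ p := by positivity
  rw [Prod.norm_def]
  rcases max_choice ‖z.1‖ ‖z.2‖ with h | h <;> rw [h] <;> linarith

/-- A continuous positively `p`-homogeneous map is Hölder-type continuous at the scale `p`. -/
theorem exists_norm_sub_le_of_homogeneous {V Y : Type*} [NormedAddCommGroup V] [NormedSpace ℝ V]
    [FiniteDimensional ℝ V] [NormedAddCommGroup Y] [NormedSpace ℝ Y] {p : ℝ} (hp : 0 < p)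
    {q : V → Y} (hq : Continuous q) (hqh : ∀ t : ℝ, 0 < t → ∀ z, q (t • z) = t ^ p • q z)
    {δ : ℝ} (hδ : 0 < δ) :
    ∃ C : ℝ, 0 ≤ C ∧ ∀ z z', ‖q z - q z'‖ ≤ δ * (‖z‖ ^ p + ‖z'‖ ^ p) + C * ‖z - z'‖ ^ p := by
  -- The compactness lemma is used on `V × V`, with an `H` that vanishes exactly on the diagonal.
  have hH : Continuous fun w : V × V => ‖w.1 - w.2‖ ^ p :=
    (continuous_fst.sub continuous_snd).norm.rpow_const fun _ => Or.inr hp.le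
  obtain ⟨C, hC, h⟩ := exists_le_mul_rpow_norm_add_mul (V := V × V) hp
    (G := fun w => ‖q w.1 - q w.2‖) (H := fun w => ‖w.1 - w.2‖ ^ p) (by fun_prop) hH
    (fun t ht w => by
      have : 0 ≤ t ^ p := by positivity
      simp only [Prod.smul_fst, Prod.smul_snd, hqh t ht, ← smul_sub, norm_smul,
        Real.norm_of_nonneg this])
    (fun t ht w => by
      simp only [Prod.smul_fst, Prod.smul_snd, ← smul_sub, norm_smul, Real.norm_of_nonneg ht.le]
      rw [Real.mul_rpow ht.le (norm_nonneg _)])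
    (fun w => by positivity)
    (fun w hw => by
      have h0 := (Real.rpow_eq_zero (norm_nonneg _) hp.ne').1 hw
      rw [sub_eq_zero.1 (norm_eq_zero.1 h0)]
      simp) hδ
  refine ⟨C, hC, fun z z' => (h (z, z')).trans ?_⟩
  have := norm_prod_rpow_le (p := p) (z, z')
  simp only at this ⊢
  gcongr

section InnerProduct

variable {E : Type*} [NormedAddCommGroup E] [InnerProductSpace ℝ E] {p : ℝ}

/-- If the norms differ, strict convexity of `t ↦ t^p` gives the strict inequality; if they agree,
strict convexity of the inner product norm does. -/
theorem norm_rpow_midpoint_lt (hp : 1 < p) {a b : E} (hab : a ≠ b) :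
    ‖(1 / 2 : ℝ) • (a + b)‖ ^ p < (‖a‖ ^ p + ‖b‖ ^ p) / 2 := by
  have hp0 : 0 < p := by linarith
  have h1 : ‖(1 / 2 : ℝ) • (a + b)‖ ≤ (1 / 2 : ℝ) * ‖a‖ + (1 / 2 : ℝ) * ‖b‖ := by
    rw [norm_smul, Real.norm_of_nonneg (by norm_num), ← mul_add]
    gcongr
    exact norm_add_le a b
  by_cases hn : ‖a‖ = ‖b‖
  · have h2 : ‖a + b‖ < ‖a‖ + ‖b‖ := by
      refine lt_of_le_of_ne (norm_add_le a b) fun h => hab ?_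
      exact (sameRay_iff_norm_add.2 h).norm_eq_iff.1 hn
    have h3 : ‖(1 / 2 : ℝ) • (a + b)‖ < ‖b‖ := by
      rw [norm_smul, Real.norm_of_nonneg (by norm_num)]
      linarith
    have := Real.rpow_lt_rpow (norm_nonneg _) h3 hp0
    rw [hn]
    linarith
  · have h2 := (strictConvexOn_rpow hp).2 (norm_nonneg a) (norm_nonneg b) hn
      (by norm_num : (0 : ℝ) < 1 / 2) (by norm_num : (0 : ℝ) < 1 / 2) (by norm_num)
    simp only [smul_eq_mul] at h2
    have := Real.rpow_le_rpow (norm_nonneg _) h1 hp0.le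
    linarith

/-- Uniform convexity in a form that can be integrated. The midpoint defect is `p`-homogeneous,
nonnegative and, by strict convexity, zero only on the diagonal, where `‖a - b‖ ^ p` vanishes too.
-/
theorem exists_norm_sub_rpow_le_midpoint [FiniteDimensional ℝ E] (hp : 1 < p) {δ : ℝ}
    (hδ : 0 < δ) :
    ∃ C : ℝ, 0 ≤ C ∧ ∀ a b : E, ‖a - b‖ ^ p ≤ δ * (‖a‖ ^ p + ‖b‖ ^ p)
      + C * ((‖a‖ ^ p + ‖b‖ ^ p) / 2 - ‖(1 / 2 : ℝ) • (a + b)‖ ^ p) := by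
  have hp0 : 0 < p := by linarith
  have hc : ∀ f : E × E → E, Continuous f → Continuous fun w => ‖f w‖ ^ p :=
    fun f hf => hf.norm.rpow_const fun _ => Or.inr hp0.le
  have hh : ∀ t : ℝ, 0 < t → ∀ z : E, ‖t • z‖ ^ p = t ^ p * ‖z‖ ^ p := fun t ht z => by
    rw [norm_smul, Real.norm_of_nonneg ht.le, Real.mul_rpow ht.le (norm_nonneg _)]
  obtain ⟨C, hC, h⟩ := exists_le_mul_rpow_norm_add_mul (V := E × E) hp0
    (G := fun w => ‖w.1 - w.2‖ ^ p)
    (H := fun w => (‖w.1‖ ^ p + ‖w.2‖ ^ p) / 2 - ‖(1 / 2 : ℝ) • (w.1 + w.2)‖ ^ p)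
    (hc _ (by fun_prop))
    ((((hc _ continuous_fst).add (hc _ continuous_snd)).div_const 2).sub (hc _ (by fun_prop)))
    (fun t ht w => by simp only [Prod.smul_fst, Prod.smul_snd, ← smul_sub, hh t ht])
    (fun t ht w => by
      simp only [Prod.smul_fst, Prod.smul_snd, ← smul_add, smul_comm _ t, hh t ht]
      ring)
    (fun w => by
      by_cases hw : w.1 = w.2
      · rw [hw, ← two_smul ℝ w.2, smul_smul]
        norm_num
      · linarith [norm_rpow_midpoint_lt hp hw])
    (fun w hw => by
      by_cases hw' : w.1 = w.2
      · simp [hw', hp0.ne']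
      · linarith [norm_rpow_midpoint_lt hp hw']) hδ
  refine ⟨C, hC, fun z z' => (h (z, z')).trans ?_⟩
  have := norm_prod_rpow_le (p := p) (z, z')
  simp only at this ⊢
  gcongr

/-- The duality map `b ↦ |b|^{p-2} b`. -/
noncomputable def powMap (p : ℝ) (b : E) : E := ‖b‖ ^ (p - 2) • b

theorem norm_powMap (hp : 1 < p) (b : E) : ‖powMap p b‖ = ‖b‖ ^ (p - 1) := by
  rw [powMap, norm_smul, Real.norm_of_nonneg (by positivity),
    ← Real.rpow_add_one' (norm_nonneg _) (by linarith)]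
  congr 1
  ring

/-- Only the origin needs care: for `p < 2` the factor `‖b‖ ^ (p - 2)` is singular, but the norm of
the product is `‖b‖ ^ (p - 1)`, which tends to zero. -/
theorem continuous_powMap (hp : 1 < p) : Continuous (powMap p : E → E) := by
  rw [continuous_iff_continuousAt]
  intro b
  rcases eq_or_ne b 0 with rfl | hb
  · rw [ContinuousAt, tendsto_iff_norm_sub_tendsto_zero]
    have h0 : powMap p (0 : E) = 0 := by simp [powMap]
    simp only [h0, sub_zero, norm_powMap hp]
    have : ContinuousAt (fun b : E => ‖b‖ ^ (p - 1)) 0 :=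
      continuous_norm.continuousAt.rpow_const (Or.inr (by linarith))
    simpa [ContinuousAt, sub_ne_zero_of_ne hp.ne'] using this
  · exact (continuous_norm.continuousAt.rpow_const (Or.inl (norm_ne_zero_iff.2 hb))).smul
      continuousAt_id

theorem powMap_smul (hp : 1 < p) {t : ℝ} (ht : 0 ≤ t) (b : E) :
    powMap p (t • b) = t ^ (p - 1) • powMap p b := by
  rw [powMap, powMap, norm_smul, Real.norm_of_nonneg ht, Real.mul_rpow ht (norm_nonneg _),
    smul_smul, smul_smul]
  congr 1
  rw [mul_right_comm, ← Real.rpow_add_one' ht (by linarith)]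
  ring_nf

theorem inner_powMap_self (hp : 1 < p) (b : E) : inner ℝ (powMap p b) b = ‖b‖ ^ p := by
  rw [powMap, inner_smul_left, real_inner_self_eq_norm_sq]
  simp only [conj_trivial]
  rw [← Real.rpow_natCast, ← Real.rpow_add' (norm_nonneg _) (by norm_num; linarith)]
  norm_num

theorem abs_inner_powMap_le (hp : 1 < p) (b ξ : E) :
    |inner ℝ (powMap p b) ξ| ≤ ‖b‖ ^ (p - 1) * ‖ξ‖ := by
  simpa [norm_powMap hp] using abs_real_inner_le_norm (powMap p b) ξ

/-- Young's inequality for the exponents `p` and `p / (p - 1)`. -/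
theorem mul_rpow_sub_one_mul_le (hp : 1 < p) {s t : ℝ} (hs : 0 ≤ s) (ht : 0 ≤ t) :
    p * (s ^ (p - 1) * t) ≤ t ^ p + (p - 1) * s ^ p := by
  have hpq : p.HolderConjugate (p / (p - 1)) := Real.HolderConjugate.conjExponent hp
  have h := Real.young_inequality_of_nonneg ht (by positivity : 0 ≤ s ^ (p - 1)) hpq
  rw [← Real.rpow_mul hs, mul_div_cancel₀ _ (by linarith)] at h
  have h1 : p * (t ^ p / p + s ^ p / (p / (p - 1))) = t ^ p + (p - 1) * s ^ p := by
    field_simp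
  rw [← h1]
  nlinarith

theorem convexOn_norm_rpow (hp : 1 ≤ p) : ConvexOn ℝ Set.univ fun ξ : E => ‖ξ‖ ^ p := by
  refine ⟨convex_univ, fun x _ y _ a b ha hb hab => ?_⟩
  have h1 : ‖a • x + b • y‖ ≤ a * ‖x‖ + b * ‖y‖ := by
    refine (norm_add_le _ _).trans_eq ?_
    rw [norm_smul, norm_smul, Real.norm_of_nonneg ha, Real.norm_of_nonneg hb]
  exact (Real.rpow_le_rpow (norm_nonneg _) h1 (by linarith)).trans
    ((convexOn_rpow hp).2 (norm_nonneg x) (norm_nonneg y) ha hb hab)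

end InnerProduct

end Pointwise

/-! ### Norms, uniform convexity and integral functionals on `L^p`. -/

section LpFunctionals

section LpNorms

variable {α : Type*} [MeasurableSpace α] {μ : Measure α} {p : ℝ}
variable {F : Type*} [NormedAddCommGroup F]

theorem _root_.MeasureTheory.MemLp.integrable_norm_rpow_ofReal (hp : 1 < p) {g : α → F}
    (hg : MemLp g (ENNReal.ofReal p) μ) : Integrable (fun x => ‖g x‖ ^ p) μ := by
  have h := hg.integrable_norm_rpow (by simpa using by linarith) ENNReal.ofReal_ne_top
  rwa [ENNReal.toReal_ofReal (by linarith)] at h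

theorem memLp_ofReal_of_integrable (hp : 1 < p) {g : α → F} (hm : AEStronglyMeasurable g μ)
    (hg : Integrable (fun x => ‖g x‖ ^ p) μ) : MemLp g (ENNReal.ofReal p) μ := by
  rw [← integrable_norm_rpow_iff hm (by simpa using by linarith) ENNReal.ofReal_ne_top,
    ENNReal.toReal_ofReal (by linarith)]
  exact hg

variable [Fact (1 < p)]

theorem _root_.MeasureTheory.Lp.integrable_norm_rpow (g : Lp F (ENNReal.ofReal p) μ) :
    Integrable (fun x => ‖g x‖ ^ p) μ :=
  (Lp.memLp g).integrable_norm_rpow_ofReal Fact.out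

theorem norm_rpow_eq_integral (g : Lp F (ENNReal.ofReal p) μ) :
    ‖g‖ ^ p = ∫ x, ‖g x‖ ^ p ∂μ := by
  have hp : 1 < p := Fact.out
  have hp0 : 0 < p := by linarith
  rw [Lp.norm_def, toReal_eLpNorm (Lp.aestronglyMeasurable g),
    lpNorm_eq_integral_norm_rpow_toReal (by simpa using hp0) ENNReal.ofReal_ne_top
      (Lp.aestronglyMeasurable g), ENNReal.toReal_ofReal hp0.le, ← Real.rpow_mul
      (integral_nonneg fun x => by positivity), inv_mul_cancel₀ hp0.ne', Real.rpow_one]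

theorem norm_sub_rpow_eq_integral (g h : Lp F (ENNReal.ofReal p) μ) :
    ‖g - h‖ ^ p = ∫ x, ‖g x - h x‖ ^ p ∂μ := by
  rw [norm_rpow_eq_integral]
  apply integral_congr_ae
  filter_upwards [Lp.coeFn_sub g h] with x hx
  rw [hx, Pi.sub_apply]

theorem integrable_norm_sub_rpow (g h : Lp F (ENNReal.ofReal p) μ) :
    Integrable (fun x => ‖g x - h x‖ ^ p) μ :=
  ((Lp.memLp g).sub (Lp.memLp h)).integrable_norm_rpow_ofReal Fact.out

end LpNorms

section UniformConvexity

variable {α : Type*} [MeasurableSpace α] {μ : Measure α} {p : ℝ} [hp : Fact (1 < p)]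
variable {E : Type*} [NormedAddCommGroup E] [InnerProductSpace ℝ E] [FiniteDimensional ℝ E]

theorem exists_Lp_norm_sub_rpow_le_midpoint {δ : ℝ} (hδ : 0 < δ) :
    ∃ C : ℝ, 0 ≤ C ∧ ∀ g h : Lp E (ENNReal.ofReal p) μ, ‖g - h‖ ^ p ≤ δ * (‖g‖ ^ p + ‖h‖ ^ p)
      + C * ((‖g‖ ^ p + ‖h‖ ^ p) / 2 - ‖(1 / 2 : ℝ) • (g + h)‖ ^ p) := by
  obtain ⟨C, hC, hle⟩ := exists_norm_sub_rpow_le_midpoint (E := E) hp.out hδ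
  refine ⟨C, hC, fun g h => ?_⟩
  have hm : ‖(1 / 2 : ℝ) • (g + h)‖ ^ p = ∫ x, ‖(1 / 2 : ℝ) • (g x + h x)‖ ^ p ∂μ := by
    rw [norm_rpow_eq_integral]
    apply integral_congr_ae
    filter_upwards [Lp.coeFn_smul (1 / 2 : ℝ) (g + h), Lp.coeFn_add g h] with x hx hx'
    rw [hx, Pi.smul_apply, hx', Pi.add_apply]
  have ig := Lp.integrable_norm_rpow g
  have ih := Lp.integrable_norm_rpow h
  have im : Integrable (fun x => ‖(1 / 2 : ℝ) • (g x + h x)‖ ^ p) μ :=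
    (((Lp.memLp g).add (Lp.memLp h)).const_smul (1 / 2 : ℝ)).integrable_norm_rpow_ofReal hp.out
  have is : Integrable (fun x => ‖g x‖ ^ p + ‖h x‖ ^ p) μ := ig.add ih
  have id : Integrable (fun x => (‖g x‖ ^ p + ‖h x‖ ^ p) / 2
    - ‖(1 / 2 : ℝ) • (g x + h x)‖ ^ p) μ := (is.div_const 2).sub im
  rw [hm, norm_sub_rpow_eq_integral, norm_rpow_eq_integral, norm_rpow_eq_integral,
    ← integral_add ig ih, ← integral_const_mul, ← integral_div,
    ← integral_sub (is.div_const 2) im, ← integral_const_mul,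
    ← integral_add (is.const_mul δ) (id.const_mul C)]
  exact integral_mono (integrable_norm_sub_rpow g h)
    ((is.const_mul δ).add (id.const_mul C)) fun x => hle (g x) (h x)

/-- Convex combinations of the tails of a sequence can be chosen to converge in `L^p`. -/
theorem exists_mem_convexHull_cauchySeq {X : Type*} [AddCommGroup X] [Module ℝ X]
    (T : X →ₗ[ℝ] Lp E (ENNReal.ofReal p) μ) (w : ℕ → X) {R : ℝ} (hR : ∀ k, ‖T (w k)‖ ≤ R) :
    ∃ v : ℕ → X, (∀ n, v n ∈ convexHull ℝ (w '' Set.Ici n)) ∧ CauchySeq fun n => T (v n) := by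
  have hp0 : 0 < p := by linarith [hp.out]
  set K : ℕ → Set X := fun n => convexHull ℝ (w '' Set.Ici n) with hK
  have hKR : ∀ n, ∀ v ∈ K n, ‖T v‖ ≤ R := by
    intro n v hv
    have hc : Convex ℝ (T ⁻¹' Metric.closedBall 0 R) :=
      (convex_closedBall 0 R).linear_preimage T
    have : K n ⊆ T ⁻¹' Metric.closedBall 0 R := by
      refine convexHull_min ?_ hc
      rintro _ ⟨k, -, rfl⟩
      simpa using hR k
    simpa using this hv
  have hR0 : 0 ≤ R := (norm_nonneg _).trans (hR 0)
  have hKR' : ∀ n, ∀ v ∈ K n, ‖T v‖ ^ p ≤ R ^ p := fun n v hv =>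
    Real.rpow_le_rpow (norm_nonneg _) (hKR n v hv) hp0.le
  have hwK : ∀ n, w n ∈ K n := fun n => subset_convexHull _ _ ⟨n, Set.self_mem_Ici, rfl⟩
  have hanti : ∀ m n, m ≤ n → K n ⊆ K m := fun m n hmn =>
    convexHull_mono (Set.image_mono (Set.Ici_subset_Ici.2 hmn))
  set S : ℕ → Set ℝ := fun n => (fun v => ‖T v‖ ^ p) '' K n with hS
  have hSb : ∀ n, BddBelow (S n) := fun n => ⟨0, by rintro _ ⟨v, -, rfl⟩; positivity⟩
  have hSn : ∀ n, (S n).Nonempty := fun n => ⟨_, w n, hwK n, rfl⟩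
  -- The infima of `‖T v‖ ^ p` over the hulls of the tails increase to a finite limit `D`.
  -- Near-minimizers then form a Cauchy sequence, as in the projection onto a convex set.
  set d : ℕ → ℝ := fun n => sInf (S n) with hd
  have hdmono : Monotone d := fun m n hmn =>
    csInf_le_csInf (hSb m) (hSn n) (Set.image_mono (hanti m n hmn))
  have hdb : BddAbove (Set.range d) := by
    refine ⟨R ^ p, ?_⟩
    rintro _ ⟨n, rfl⟩
    exact (csInf_le (hSb n) ⟨w n, hwK n, rfl⟩).trans (hKR' n _ (hwK n))
  have hex : ∀ n : ℕ, ∃ v ∈ K n, ‖T v‖ ^ p < d n + 1 / ((n : ℝ) + 1) := by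
    intro n
    obtain ⟨_, ⟨v, hv, rfl⟩, hlt⟩ := exists_lt_of_csInf_lt (hSn n)
      (lt_add_of_pos_right (d n) (by positivity : (0 : ℝ) < 1 / ((n : ℝ) + 1)))
    exact ⟨v, hv, hlt⟩
  choose v hvK hvd using hex
  refine ⟨v, hvK, ?_⟩
  have hlim := tendsto_atTop_ciSup hdmono hdb
  set D := ⨆ n, d n
  have hdD : ∀ n, d n ≤ D := fun n => le_ciSup hdb n
  rw [Metric.cauchySeq_iff']
  intro ε hε
  have hεp : 0 < ε ^ p := by positivity
  obtain ⟨δ, hδ, hδR⟩ : ∃ δ : ℝ, 0 < δ ∧ δ * (R ^ p + R ^ p) < ε ^ p / 2 := by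
    refine ⟨ε ^ p / 2 / (R ^ p + R ^ p + 1), by positivity, ?_⟩
    rw [div_mul_eq_mul_div, div_lt_iff₀ (by positivity)]
    nlinarith
  obtain ⟨C, hC, hle⟩ := exists_Lp_norm_sub_rpow_le_midpoint (μ := μ) (E := E) (p := p) hδ
  have hsmall : Filter.Tendsto (fun n : ℕ => C * ((D - d n) + 1 / ((n : ℝ) + 1))) Filter.atTop
      (nhds 0) := by
    have := ((tendsto_const_nhds (x := D)).sub hlim).add
      (tendsto_one_div_add_atTop_nhds_zero_nat (𝕜 := ℝ))
    simpa using this.const_mul C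
  obtain ⟨n, hn⟩ := (hsmall.eventually (gt_mem_nhds (half_pos hεp))).exists
  refine ⟨n, fun m hm => ?_⟩
  rw [dist_eq_norm]
  have hvm : v m ∈ K n := hanti n m hm (hvK m)
  -- The midpoint lies in the hull `K n`, so it cannot go below `d n`; this makes the midpoint
  -- defect small.
  have hmid : d n ≤ ‖(1 / 2 : ℝ) • (T (v m) + T (v n))‖ ^ p := by
    refine csInf_le (hSb n) ⟨(1 / 2 : ℝ) • (v m + v n), ?_, by simp⟩
    rw [smul_add]
    exact (convex_convexHull ℝ _) hvm (hvK n) (by norm_num) (by norm_num) (by norm_num)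
  have h1 := hle (T (v m)) (T (v n))
  have h2 : (‖T (v m)‖ ^ p + ‖T (v n)‖ ^ p) / 2 - ‖(1 / 2 : ℝ) • (T (v m) + T (v n))‖ ^ p
      ≤ (D - d n) + 1 / ((n : ℝ) + 1) := by
    have h3 := hvd m
    have h4 := hvd n
    have h5 : 1 / ((m : ℝ) + 1) ≤ 1 / ((n : ℝ) + 1) := by gcongr
    linarith [hdD m, hdD n]
  have h6 : δ * (‖T (v m)‖ ^ p + ‖T (v n)‖ ^ p) ≤ δ * (R ^ p + R ^ p) := by
    gcongr
    exacts [hKR n _ hvm, hKR n _ (hvK n)]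
  have h7 := mul_le_mul_of_nonneg_left h2 hC
  refine (Real.rpow_lt_rpow_iff (norm_nonneg _) hε.le hp0).1 ?_
  linarith

end UniformConvexity

section Gateaux

variable {α : Type*} [MeasurableSpace α] {μ : Measure α} {p : ℝ}
variable {E : Type*} [NormedAddCommGroup E] [InnerProductSpace ℝ E]

/-- Differentiation under the integral sign. For `|t| < 1` Young's inequality dominates the
derivative by an integrable function independent of `t`. It serves both the gradient term and,
applied to `u / |x|`, the Hardy term. -/
theorem integrable_inner_powMap_and_hasDerivAt (hp : 1 < p) {g h : α → E}
    (hg : MemLp g (ENNReal.ofReal p) μ) (hh : MemLp h (ENNReal.ofReal p) μ) :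
    Integrable (fun x => inner ℝ (powMap p (g x)) (h x)) μ ∧
    HasDerivAt (fun t : ℝ => ∫ x, ‖g x + t • h x‖ ^ p ∂μ)
      (p * ∫ x, inner ℝ (powMap p (g x)) (h x) ∂μ) 0 := by
  have hp0 : 0 < p := by linarith
  have hm : ∀ t : ℝ, MemLp (fun x => g x + t • h x) (ENNReal.ofReal p) μ :=
    fun t => hg.add (hh.const_smul t)
  have key := hasDerivAt_integral_of_dominated_loc_of_deriv_le (μ := μ) (𝕜 := ℝ) (x₀ := 0)
    (F := fun t x => ‖g x + t • h x‖ ^ p)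
    (F' := fun t x => p * inner ℝ (powMap p (g x + t • h x)) (h x))
    (bound := fun x => ‖h x‖ ^ p + (p - 1) * ‖‖g x‖ + ‖h x‖‖ ^ p)
    (Metric.ball_mem_nhds (0 : ℝ) one_pos)
    (Filter.Eventually.of_forall fun t =>
      ((hm t).integrable_norm_rpow_ofReal hp).aestronglyMeasurable)
    ((hm 0).integrable_norm_rpow_ofReal hp)
    ((((continuous_powMap hp).comp_aestronglyMeasurable (hm 0).1).inner hh.1).const_mul p)
    (Filter.Eventually.of_forall fun x t ht => by
      have ht' : |t| ≤ 1 := by simpa using (Metric.mem_ball.1 ht).le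
      have h1 : ‖g x + t • h x‖ ≤ ‖g x‖ + ‖h x‖ := by
        refine (norm_add_le _ _).trans ?_
        rw [norm_smul, Real.norm_eq_abs]
        gcongr
        exact mul_le_of_le_one_left (norm_nonneg _) ht'
      rw [norm_mul, Real.norm_of_nonneg hp0.le, Real.norm_of_nonneg (by positivity :
        0 ≤ ‖g x‖ + ‖h x‖)]
      refine le_trans ?_ (mul_rpow_sub_one_mul_le hp (by positivity) (norm_nonneg (h x)))
      gcongr
      refine (abs_inner_powMap_le hp _ _).trans ?_
      have : 0 ≤ p - 1 := by linarith
      gcongr)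
    ((hh.integrable_norm_rpow_ofReal hp).add
      (((hg.norm.add hh.norm).integrable_norm_rpow_ofReal hp).const_mul (p - 1)))
    (Filter.Eventually.of_forall fun x t _ => by
      have h1 : HasDerivAt (fun t : ℝ => g x + t • h x) (h x) t := by
        simpa using ((hasDerivAt_id t).smul_const (h x)).const_add (g x)
      have h2 := (hasFDerivAt_norm_rpow (g x + t • h x) hp).comp_hasDerivAt t h1
      convert! h2 using 1
      rw [powMap, inner_smul_left, smul_apply, innerSL_apply_apply]
      simp [mul_assoc])
  simp only [zero_smul, add_zero, integral_const_mul] at key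
  refine ⟨?_, key.2⟩
  have := key.1.const_mul p⁻¹
  simpa [← mul_assoc, inv_mul_cancel₀ hp0.ne'] using this

end Gateaux

section Functional

variable {α : Type*} [MeasurableSpace α] {μ : Measure α} {p : ℝ} [hp : Fact (1 < p)]
variable {E : Type*} [NormedAddCommGroup E] [InnerProductSpace ℝ E]

/-- `k |ξ|^p + |s|^{p-2} s (F · ξ) + m |s|^p`. -/
noncomputable def density (p k : ℝ) (F : E) (m s : ℝ) (ξ : E) : ℝ :=
  k * ‖ξ‖ ^ p + powMap p s * inner ℝ F ξ + m * ‖s‖ ^ p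

/-- The density is linear in its coefficients and built from the one homogeneous map `q`, so the
estimate for `q` gives a constant depending on the coefficients only through their bound `M`. -/
theorem exists_abs_density_sub_le [FiniteDimensional ℝ E] (M : ℝ) {δ : ℝ} (hδ : 0 < δ) :
    ∃ C : ℝ, 0 ≤ C ∧ ∀ (k : ℝ) (F : E) (m : ℝ), |k| ≤ M → ‖F‖ ≤ M → |m| ≤ M →
      ∀ (s s' : ℝ) (ξ ξ' : E), |density p k F m s ξ - density p k F m s' ξ'| ≤
        δ * (‖s‖ ^ p + ‖ξ‖ ^ p + (‖s'‖ ^ p + ‖ξ'‖ ^ p))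
          + C * (‖s - s'‖ ^ p + ‖ξ - ξ'‖ ^ p) := by
  have hp0 : 0 < p := by linarith [hp.out]
  let q : ℝ × E → ℝ × E × ℝ := fun z => (‖z.2‖ ^ p, powMap p z.1 • z.2, ‖z.1‖ ^ p)
  have hq : Continuous q :=
    (continuous_snd.norm.rpow_const fun _ => Or.inr hp0.le).prodMk
      ((((continuous_powMap hp.out).comp continuous_fst).smul continuous_snd).prodMk
      (continuous_fst.norm.rpow_const fun _ => Or.inr hp0.le))
  have hqh : ∀ t : ℝ, 0 < t → ∀ z, q (t • z) = t ^ p • q z := by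
    intro t ht z
    have h1 : t ^ p = t ^ (p - 1) * t := by
      rw [← Real.rpow_add_one ht.ne']
      ring_nf
    have h2 : powMap p (t * z.1) = t ^ (p - 1) * powMap p z.1 := powMap_smul hp.out ht.le z.1
    simp only [q, Prod.smul_fst, Prod.smul_snd, norm_smul, Real.norm_of_nonneg ht.le,
      Real.mul_rpow ht.le (norm_nonneg _), Prod.smul_mk, smul_eq_mul, h2, smul_smul, norm_mul]
    rw [h1]
    ring_nf
  -- Three terms, each at most `|M| * ‖y‖`; the added `1` keeps the divisor of `δ` positive.
  have hM : 0 < 3 * |M| + 1 := by positivity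
  obtain ⟨C, hC, hle⟩ := exists_norm_sub_le_of_homogeneous hp0 hq hqh
    (div_pos hδ hM)
  refine ⟨(3 * |M| + 1) * C, by positivity, fun k F m hk hF hm s s' ξ ξ' => ?_⟩
  have h1 := hle (s, ξ) (s', ξ')
  have h2 : |density p k F m s ξ - density p k F m s' ξ'|
      ≤ (3 * |M| + 1) * ‖q (s, ξ) - q (s', ξ')‖ := by
    have e : density p k F m s ξ - density p k F m s' ξ' =
        k * (q (s, ξ) - q (s', ξ')).1 + inner ℝ F (q (s, ξ) - q (s', ξ')).2.1
          + m * (q (s, ξ) - q (s', ξ')).2.2 := by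
      simp only [density, q, Prod.fst_sub, Prod.snd_sub, inner_sub_right, inner_smul_right]
      ring
    rw [e]
    set y := q (s, ξ) - q (s', ξ')
    have hM' := le_abs_self M
    have b1 : |k * y.1| ≤ |M| * ‖y‖ := by
      rw [abs_mul]
      exact mul_le_mul (hk.trans hM') (norm_fst_le y) (abs_nonneg _) (abs_nonneg _)
    have b2 : |inner ℝ F y.2.1| ≤ |M| * ‖y‖ :=
      (abs_real_inner_le_norm _ _).trans (mul_le_mul (hF.trans hM')
        ((norm_fst_le y.2).trans (norm_snd_le y)) (norm_nonneg _) (abs_nonneg _))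
    have b3 : |m * y.2.2| ≤ |M| * ‖y‖ := by
      rw [abs_mul]
      exact mul_le_mul (hm.trans hM') ((norm_snd_le y.2).trans (norm_snd_le y)) (abs_nonneg _)
        (abs_nonneg _)
    have := abs_add_three (k * y.1) (inner ℝ F y.2.1) (m * y.2.2)
    nlinarith [norm_nonneg y]
  have n1 := norm_prod_rpow_le (p := p) (s, ξ)
  have n2 := norm_prod_rpow_le (p := p) (s', ξ')
  have n3 := norm_prod_rpow_le (p := p) ((s, ξ) - (s', ξ'))
  simp only [Prod.fst_sub, Prod.snd_sub] at n1 n2 n3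
  have h3 : ‖q (s, ξ) - q (s', ξ')‖ ≤ δ / (3 * |M| + 1) *
      (‖s‖ ^ p + ‖ξ‖ ^ p + (‖s'‖ ^ p + ‖ξ'‖ ^ p)) + C * (‖s - s'‖ ^ p + ‖ξ - ξ'‖ ^ p) := by
    refine h1.trans ?_
    gcongr
  refine h2.trans ((mul_le_mul_of_nonneg_left h3 hM.le).trans_eq ?_)
  field_simp

/-- Bounded measurable coefficients of a `density`. -/
structure IsCoeff (μ : Measure α) (k : α → ℝ) (F : α → E) (m : α → ℝ) (M : ℝ) : Prop where
  meas₁ : AEStronglyMeasurable k μ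
  meas₂ : AEStronglyMeasurable F μ
  meas₃ : AEStronglyMeasurable m μ
  bound₁ : ∀ x, |k x| ≤ M
  bound₂ : ∀ x, ‖F x‖ ≤ M
  bound₃ : ∀ x, |m x| ≤ M

variable {k : α → ℝ} {F : α → E} {m : α → ℝ} {M : ℝ}

theorem IsCoeff.aestronglyMeasurable_density (h : IsCoeff μ k F m M) {u : α → ℝ} {g : α → E}
    (hu : AEStronglyMeasurable u μ) (hg : AEStronglyMeasurable g μ) :
    AEStronglyMeasurable (fun x => density p (k x) (F x) (m x) (u x) (g x)) μ := by
  have hp0 : 0 < p := by linarith [hp.out]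
  have hc : Continuous fun t : ℝ => t ^ p := continuous_id.rpow_const fun _ => Or.inr hp0.le
  exact ((h.meas₁.mul (hc.comp_aestronglyMeasurable hg.norm)).add
    (((continuous_powMap hp.out).comp_aestronglyMeasurable hu).mul (h.meas₂.inner hg))).add
    (h.meas₃.mul (hc.comp_aestronglyMeasurable hu.norm))

theorem IsCoeff.integrable_density [FiniteDimensional ℝ E] (h : IsCoeff μ k F m M)
    (w : Lp ℝ (ENNReal.ofReal p) μ × Lp E (ENNReal.ofReal p) μ) :
    Integrable (fun x => density p (k x) (F x) (m x) (w.1 x) (w.2 x)) μ := by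
  have hp0 : 0 < p := by linarith [hp.out]
  obtain ⟨C, hC, hle⟩ := exists_abs_density_sub_le (p := p) (E := E) M one_pos
  have i1 := Lp.integrable_norm_rpow w.1
  have i2 := Lp.integrable_norm_rpow w.2
  refine Integrable.mono' (((i1.add i2).const_mul 1).add ((i1.add i2).const_mul C))
    (h.aestronglyMeasurable_density (Lp.aestronglyMeasurable _) (Lp.aestronglyMeasurable _))
    (Filter.Eventually.of_forall fun x => ?_)
  -- Comparison with the zero pair, at which the density vanishes.
  have := hle (k x) (F x) (m x) (h.bound₁ x) (h.bound₂ x) (h.bound₃ x) (w.1 x) 0 (w.2 x) 0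
  have z : density p (k x) (F x) (m x) 0 0 = 0 := by simp [density, powMap, hp0.ne']
  simpa [z, hp0.ne'] using this

/-- `∫ k |∇u|^p + |u|^{p-2} u (F · ∇u) + m |u|^p dμ` for `w = (u, ∇u)`. -/
noncomputable def functional (k : α → ℝ) (F : α → E) (m : α → ℝ)
    (w : Lp ℝ (ENNReal.ofReal p) μ × Lp E (ENNReal.ofReal p) μ) : ℝ :=
  ∫ x, density p (k x) (F x) (m x) (w.1 x) (w.2 x) ∂μ

/-- The pointwise estimate, integrated. On bounded sets the first term is made small by `δ`, and the
second by closeness of the arguments. -/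
theorem IsCoeff.exists_abs_functional_sub_le [FiniteDimensional ℝ E] (h : IsCoeff μ k F m M)
    {δ : ℝ} (hδ : 0 < δ) :
    ∃ C : ℝ, 0 ≤ C ∧ ∀ w w' : Lp ℝ (ENNReal.ofReal p) μ × Lp E (ENNReal.ofReal p) μ,
      |functional k F m w - functional k F m w'| ≤
        δ * (‖w.1‖ ^ p + ‖w.2‖ ^ p + (‖w'.1‖ ^ p + ‖w'.2‖ ^ p))
          + C * (‖w.1 - w'.1‖ ^ p + ‖w.2 - w'.2‖ ^ p) := by
  obtain ⟨C, hC, hle⟩ := exists_abs_density_sub_le (p := p) (E := E) M hδ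
  refine ⟨C, hC, fun w w' => ?_⟩
  have i1 := Lp.integrable_norm_rpow w.1
  have i2 := Lp.integrable_norm_rpow w.2
  have i1' := Lp.integrable_norm_rpow w'.1
  have i2' := Lp.integrable_norm_rpow w'.2
  have j1 := integrable_norm_sub_rpow w.1 w'.1
  have j2 := integrable_norm_sub_rpow w.2 w'.2
  have i : Integrable (fun x => ‖w.1 x‖ ^ p + ‖w.2 x‖ ^ p) μ := i1.add i2
  have i' : Integrable (fun x => ‖w'.1 x‖ ^ p + ‖w'.2 x‖ ^ p) μ := i1'.add i2'
  have ii : Integrable (fun x => ‖w.1 x‖ ^ p + ‖w.2 x‖ ^ p + (‖w'.1 x‖ ^ p + ‖w'.2 x‖ ^ p)) μ :=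
    i.add i'
  have j : Integrable (fun x => ‖w.1 x - w'.1 x‖ ^ p + ‖w.2 x - w'.2 x‖ ^ p) μ := j1.add j2
  rw [norm_sub_rpow_eq_integral, norm_sub_rpow_eq_integral]
  simp only [norm_rpow_eq_integral]
  rw [functional, functional, ← integral_sub (h.integrable_density w) (h.integrable_density w'),
    ← integral_add i1 i2, ← integral_add i1' i2', ← integral_add i i',
    ← integral_add j1 j2, ← integral_const_mul, ← integral_const_mul,
    ← integral_add (ii.const_mul δ) (j.const_mul C)]
  refine (abs_integral_le_integral_abs).trans (integral_mono
    ((h.integrable_density w).sub (h.integrable_density w')).abs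
    ((ii.const_mul δ).add (j.const_mul C)) fun x => ?_)
  exact hle _ _ _ (h.bound₁ x) (h.bound₂ x) (h.bound₃ x) _ _ _ _

theorem IsCoeff.continuous_functional [FiniteDimensional ℝ E] (h : IsCoeff μ k F m M) :
    Continuous (functional k F m :
      Lp ℝ (ENNReal.ofReal p) μ × Lp E (ENNReal.ofReal p) μ → ℝ) := by
  have hp0 : 0 < p := by linarith [hp.out]
  have hc : Continuous fun t : ℝ => t ^ p := continuous_id.rpow_const fun _ => Or.inr hp0.le
  rw [continuous_iff_continuousAt]
  intro w'
  rw [ContinuousAt, tendsto_iff_norm_sub_tendsto_zero, Metric.tendsto_nhds]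
  intro ε hε
  set B := ‖w'.1‖ ^ p + ‖w'.2‖ ^ p + (‖w'.1‖ ^ p + ‖w'.2‖ ^ p) with hB
  have hB0 : 0 ≤ B := by positivity
  obtain ⟨C, hC, hle⟩ := h.exists_abs_functional_sub_le (p := p)
    (by positivity : 0 < ε / 2 / (B + 1))
  have hcont : Continuous fun w : Lp ℝ (ENNReal.ofReal p) μ × Lp E (ENNReal.ofReal p) μ =>
      ε / 2 / (B + 1) * (‖w.1‖ ^ p + ‖w.2‖ ^ p + (‖w'.1‖ ^ p + ‖w'.2‖ ^ p))
          + C * (‖w.1 - w'.1‖ ^ p + ‖w.2 - w'.2‖ ^ p) :=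
    (continuous_const.mul (((hc.comp continuous_fst.norm).add
      (hc.comp continuous_snd.norm)).add continuous_const)).add (continuous_const.mul
      ((hc.comp (continuous_fst.sub continuous_const).norm).add
      (hc.comp (continuous_snd.sub continuous_const).norm)))
  have hlt : ε / 2 / (B + 1) * (‖w'.1‖ ^ p + ‖w'.2‖ ^ p + (‖w'.1‖ ^ p + ‖w'.2‖ ^ p))
          + C * (‖w'.1 - w'.1‖ ^ p + ‖w'.2 - w'.2‖ ^ p) < ε := by
    simp only [sub_self, norm_zero, Real.zero_rpow hp0.ne', add_zero, mul_zero]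
    rw [← hB, div_mul_eq_mul_div, div_lt_iff₀ (by positivity)]
    nlinarith
  filter_upwards [hcont.continuousAt.eventually (gt_mem_nhds hlt)] with w hw
  rw [dist_zero_right, norm_norm]
  exact (hle w w').trans_lt hw

end Functional

end LpFunctionals

/-! ### Closedness of the Sobolev spaces and reduction to test functions. -/

section SobolevZero

/-- Hölder's inequality. It gives closedness of the weak gradient relation and, later, the local
averages used for compactness. -/
theorem exists_clm_eq_integral_inner {α E : Type*} [MeasurableSpace α] {μ : Measure α}
    [NormedAddCommGroup E] [InnerProductSpace ℝ E] {p : ℝ} [hp : Fact (1 < p)] {ψ : α → E}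
    (hψ : MemLp ψ (ENNReal.ofReal (p / (p - 1))) μ) :
    ∃ l : Lp E (ENNReal.ofReal p) μ →L[ℝ] ℝ, ∀ g, l g = ∫ x, inner ℝ (ψ x) (g x) ∂μ := by
  have hpq : p.HolderConjugate (p / (p - 1)) := Real.HolderConjugate.conjExponent hp.out
  have : Fact (1 < p / (p - 1)) := ⟨hpq.symm.lt⟩
  have : ENNReal.HolderConjugate (ENNReal.ofReal (p / (p - 1))) (ENNReal.ofReal p) :=
    hpq.symm.ennrealOfReal
  refine ⟨(innerSL ℝ).lpPairing μ (ENNReal.ofReal (p / (p - 1))) (ENNReal.ofReal p)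
    (hψ.toLp ψ), fun g => ?_⟩
  rw [ContinuousLinearMap.lpPairing_eq_integral]
  apply integral_congr_ae
  filter_upwards [hψ.coeFn_toLp] with x hx
  rw [hx, innerSL_apply_apply]

theorem continuous_integral_inner {α E : Type*} [MeasurableSpace α] {μ : Measure α}
    [NormedAddCommGroup E] [InnerProductSpace ℝ E] {p : ℝ} [Fact (1 < p)] {ψ : α → E}
    (hψ : MemLp ψ (ENNReal.ofReal (p / (p - 1))) μ) :
    Continuous fun g : Lp E (ENNReal.ofReal p) μ => ∫ x, inner ℝ (ψ x) (g x) ∂μ := by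
  obtain ⟨l, hl⟩ := exists_clm_eq_integral_inner hψ
  exact l.continuous.congr hl

variable {N : ℕ} {Ω : Set (Space N)} {p : ℝ} [hp : Fact (1 < p)]

theorem isClosed_sobolev : IsClosed (sobolev Ω p : Set (LpOn Ω p ℝ × LpOn Ω p (Space N))) := by
  have h : (sobolev Ω p : Set (LpOn Ω p ℝ × LpOn Ω p (Space N))) =
      ⋂ (φ : Space N → ℝ) (_ : IsTestFunction Ω φ) (v : Space N),
        {w | ∫ x in Ω, w.1 x * fderiv ℝ φ x v = - ∫ x in Ω, φ x * inner ℝ v (w.2 x)} := by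
    ext w
    simp only [Set.mem_iInter]
    rfl
  rw [h]
  refine isClosed_iInter fun φ => isClosed_iInter fun hφ => isClosed_iInter fun v => ?_
  have h1 := (continuous_integral_inner (p := p) (μ := volume.restrict Ω)
    ((hφ.fderiv_continuous v).memLp_of_hasCompactSupport (hφ.fderiv_compact v))).comp
    (continuous_fst (X := LpOn Ω p ℝ) (Y := LpOn Ω p (Space N)))
  have h2 := (continuous_integral_inner (p := p) (μ := volume.restrict Ω)
    ((hφ.smooth.continuous.smul (continuous_const (y := v))).memLp_of_hasCompactSupport
    hφ.compact.smul_right)).comp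
    (continuous_snd (X := LpOn Ω p ℝ) (Y := LpOn Ω p (Space N)))
  refine isClosed_eq (h1.congr fun w => ?_) (h2.neg.congr fun w => ?_)
  · simp
  · simp [inner_smul_left]

theorem isClosed_sobolevZero :
    IsClosed (sobolevZero Ω p : Set (LpOn Ω p ℝ × LpOn Ω p (Space N))) :=
  isClosed_sobolev.inter (Submodule.isClosed_topologicalClosure _)

theorem exists_isTestFunction_of_mem_testPairs {w : LpOn Ω p ℝ × LpOn Ω p (Space N)}
    (hw : w ∈ testPairs Ω p) : ∃ φ : Space N → ℝ, IsTestFunction Ω φ ∧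
      w.1 =ᵐ[volume.restrict Ω] φ ∧ w.2 =ᵐ[volume.restrict Ω] gradient φ := by
  induction hw using Submodule.span_induction with
  | mem w h => exact h
  | zero =>
    refine ⟨0, ⟨contDiff_const, HasCompactSupport.zero, by simp [tsupport]⟩,
      Lp.coeFn_zero _ _ _, ?_⟩
    filter_upwards [Lp.coeFn_zero (Space N) (ENNReal.ofReal p) (volume.restrict Ω)] with x hx
    have : (0 : LpOn Ω p ℝ × LpOn Ω p (Space N)).2 = 0 := rfl
    rw [this, hx]
    simp [gradient]
  | add a b _ _ ha hb =>
    obtain ⟨φ, hφ, h1, h2⟩ := ha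
    obtain ⟨ψ, hψ, h3, h4⟩ := hb
    refine ⟨φ + ψ, ⟨hφ.smooth.add hψ.smooth, hφ.compact.add hψ.compact,
      (tsupport_add φ ψ).trans (Set.union_subset hφ.support_subset hψ.support_subset)⟩, ?_, ?_⟩
    · filter_upwards [Lp.coeFn_add a.1 b.1, h1, h3] with x hx e1 e2
      rw [Prod.fst_add, hx, Pi.add_apply, Pi.add_apply, e1, e2]
    · filter_upwards [Lp.coeFn_add a.2 b.2, h2, h4] with x hx e1 e2
      rw [Prod.snd_add, hx, Pi.add_apply, e1, e2, gradient, gradient, gradient, fderiv_add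
        (hφ.smooth.differentiable (by simp) x) (hψ.smooth.differentiable (by simp) x), map_add]
  | smul c a _ ha =>
    obtain ⟨φ, hφ, h1, h2⟩ := ha
    refine ⟨c • φ, ⟨hφ.smooth.const_smul c, hφ.compact.smul_left (f := fun _ => c),
      (tsupport_smul_subset_right (fun _ => c) φ).trans hφ.support_subset⟩, ?_, ?_⟩
    · filter_upwards [Lp.coeFn_smul c a.1, h1] with x hx e1
      rw [Prod.smul_fst, hx, Pi.smul_apply, Pi.smul_apply, e1]
    · filter_upwards [Lp.coeFn_smul c a.2, h2] with x hx e1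
      rw [Prod.smul_snd, hx, Pi.smul_apply, e1, gradient, gradient, fderiv_const_smul
        (hφ.smooth.differentiable (by simp) x), map_smul]

/-- A closed property that holds for `C_c^∞(Ω)` holds in `W_0^{1,p}(Ω)`. -/
theorem sobolevZero_induction {P : LpOn Ω p ℝ × LpOn Ω p (Space N) → Prop}
    (hP : IsClosed {w | P w})
    (h : ∀ (φ : Space N → ℝ) (w : LpOn Ω p ℝ × LpOn Ω p (Space N)), IsTestFunction Ω φ →
      w.1 =ᵐ[volume.restrict Ω] φ → w.2 =ᵐ[volume.restrict Ω] gradient φ → P w)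
    (u : sobolevZero Ω p) : P u.1 := by
  have h1 : u.1 ∈ closure (testPairs Ω p : Set (LpOn Ω p ℝ × LpOn Ω p (Space N))) := u.2.2
  refine closure_minimal (fun w hw => ?_) hP h1
  obtain ⟨φ, hφ, h2, h3⟩ := exists_isTestFunction_of_mem_testPairs hw
  exact h φ w hφ h2 h3

end SobolevZero

/-! ### The regularised Euler field and its divergence identity. -/

section EulerField

/-- Integration by parts against the Euler vector field. -/
theorem integral_fderiv_apply_self {N : ℕ} {ψ : Space N → ℝ} (hψ : ContDiff ℝ 1 ψ)
    (hs : HasCompactSupport ψ) : ∫ x, fderiv ℝ ψ x x = -(N * ∫ x, ψ x) := by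
  have hd : Differentiable ℝ ψ := hψ.differentiable one_ne_zero
  let e : Fin N → Space N := fun i => EuclideanSpace.single i 1
  have hc : ∀ v, Continuous fun x => fderiv ℝ ψ x v := fun v =>
    (hψ.continuous_fderiv one_ne_zero).clm_apply continuous_const
  have hcs : ∀ v, HasCompactSupport fun x => fderiv ℝ ψ x v := fun v => hs.fderiv_apply (𝕜 := ℝ) v
  have hcoord : ∀ i : Fin N, Continuous fun x : Space N => x i := fun i =>
    (EuclideanSpace.proj i : Space N →L[ℝ] ℝ).continuous
  have hint : ∀ i : Fin N, Integrable fun x : Space N => x i * fderiv ℝ ψ x (e i) := fun i =>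
    ((hcoord i).mul (hc _)).integrable_of_hasCompactSupport (hcs _).mul_left
  -- Integration by parts in each coordinate, with `∂_i x_i = 1`; summing over `i` produces the
  -- factor `N`.
  have hi : ∀ i : Fin N, ∫ x : Space N, x i * fderiv ℝ ψ x (e i) = - ∫ x, ψ x := by
    intro i
    have hfd : ∀ x : Space N, fderiv ℝ (fun y : Space N => y i) x (e i) = 1 := by
      intro x
      have : HasFDerivAt (fun y : Space N => y i) (EuclideanSpace.proj i : Space N →L[ℝ] ℝ) x :=
        (EuclideanSpace.proj i : Space N →L[ℝ] ℝ).hasFDerivAt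
      rw [this.fderiv]
      simp [e]
    have hiψ := hψ.continuous.integrable_of_hasCompactSupport (μ := volume) hs
    rw [integral_mul_fderiv_eq_neg_fderiv_mul_of_integrable]
    · simp only [hfd, one_mul]
    · simpa only [hfd, one_mul] using hiψ
    · exact hint i
    · exact ((hcoord i).mul hψ.continuous).integrable_of_hasCompactSupport hs.mul_left
    · exact fun x _ => (EuclideanSpace.proj i : Space N →L[ℝ] ℝ).differentiableAt
    · exact fun x _ => hd x
  have hsum : ∀ x : Space N, fderiv ℝ ψ x x = ∑ i, x i * fderiv ℝ ψ x (e i) := by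
    intro x
    have : x = ∑ i, x i • e i := by
      ext j
      simp [e, Finset.sum_apply, Pi.single_apply]
    conv_lhs => rw [this]
    rw [map_sum, ← this]
    simp
  simp_rw [hsum]
  rw [integral_finsetSum _ fun i _ => hint i]
  simp [hi]

/-- A regularisation of `x ↦ |x|`. -/
noncomputable def regNorm {N : ℕ} (ε : ℝ) (x : Space N) : ℝ := √(‖x‖ ^ 2 + ε)

theorem norm_le_regNorm {N : ℕ} {ε : ℝ} (hε : 0 ≤ ε) (x : Space N) : ‖x‖ ≤ regNorm ε x :=
  Real.le_sqrt_of_sq_le (by linarith)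

theorem sqrt_le_regNorm {N : ℕ} {ε : ℝ} (x : Space N) : √ε ≤ regNorm ε x :=
  Real.sqrt_le_sqrt (by nlinarith [sq_nonneg ‖x‖])

theorem regNorm_pos {N : ℕ} {ε : ℝ} (hε : 0 < ε) (x : Space N) : 0 < regNorm ε x :=
  (Real.sqrt_pos.2 hε).trans_le (sqrt_le_regNorm x)

theorem regNorm_rpow {N : ℕ} {ε : ℝ} (hε : 0 < ε) (x : Space N) (t : ℝ) :
    regNorm ε x ^ t = (‖x‖ ^ 2 + ε) ^ (t / 2) := by
  rw [regNorm, Real.sqrt_eq_rpow, ← Real.rpow_mul (by positivity)]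
  ring_nf

theorem continuous_regNorm_rpow {N : ℕ} {ε : ℝ} (hε : 0 < ε) (t : ℝ) :
    Continuous fun x : Space N => regNorm ε x ^ t :=
  (Real.continuous_sqrt.comp ((continuous_norm.pow 2).add continuous_const)).rpow_const
    fun x => Or.inl (regNorm_pos hε x).ne'

theorem tendsto_regNorm_rpow {N : ℕ} (x : Space N) (hx : x ≠ 0) (t : ℝ) :
    Filter.Tendsto (fun n : ℕ => regNorm (1 / ((n : ℝ) + 1)) x ^ t) Filter.atTop
      (nhds (‖x‖ ^ t)) := by
  have h1 : Filter.Tendsto (fun n : ℕ => ‖x‖ ^ 2 + 1 / ((n : ℝ) + 1)) Filter.atTop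
      (nhds (‖x‖ ^ 2)) := by
    simpa using tendsto_const_nhds.add (tendsto_one_div_add_atTop_nhds_zero_nat (𝕜 := ℝ))
  have h2 := (Real.continuous_sqrt.tendsto _).comp h1
  rw [Real.sqrt_sq (norm_nonneg x)] at h2
  exact h2.rpow_const (Or.inl (norm_ne_zero_iff.2 hx))

/-- The vector field `p r^{-p} x`. -/
noncomputable def eulerField {N : ℕ} (p r : ℝ) (x : Space N) : Space N := (p * r ^ (-p)) • x

/-- The divergence of `x ↦ r^{-p} x`, for `r = (|x|^2 + ε)^{1/2}`. -/
noncomputable def eulerDiv {N : ℕ} (p r : ℝ) (x : Space N) : ℝ :=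
  N * r ^ (-p) - p * (‖x‖ ^ 2 * r ^ (-p - 2))

theorem sq_mul_rpow_le {p r t : ℝ} (hr : 0 < r) (ht : 0 ≤ t) (htr : t ≤ r) :
    t ^ 2 * r ^ (-p - 2) ≤ r ^ (-p) := by
  have h : r ^ (-p) = r ^ 2 * r ^ (-p - 2) := by
    rw [← Real.rpow_natCast, ← Real.rpow_add hr]
    norm_num
  rw [h]
  gcongr

theorem norm_eulerField_le {N : ℕ} {p r : ℝ} (hp : 0 < p) {x : Space N} (hr : 0 < r)
    (hx : ‖x‖ ≤ r) : ‖eulerField p r x‖ ≤ p * r⁻¹ ^ (p - 1) := by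
  have h : r⁻¹ ^ (p - 1) = r ^ (-p) * r := by
    rw [Real.inv_rpow hr.le, ← Real.rpow_neg hr.le, ← Real.rpow_add_one hr.ne']
    ring_nf
  rw [eulerField, norm_smul, Real.norm_of_nonneg (by positivity), h, mul_assoc]
  gcongr

/-- Since `‖x‖ ≤ r`, regularising keeps the divergence above its singular form with `r` in place of
`‖x‖`, so no constant is lost in Hardy's inequality. -/
theorem le_eulerDiv {N : ℕ} {p r : ℝ} (hp : 0 < p) {x : Space N} (hr : 0 < r) (hx : ‖x‖ ≤ r) :
    (N - p) * r ^ (-p) ≤ eulerDiv p r x := by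
  have := mul_le_mul_of_nonneg_left (sq_mul_rpow_le (p := p) hr (norm_nonneg x) hx) hp.le
  rw [eulerDiv]
  linarith

theorem abs_eulerDiv_le {N : ℕ} {p r : ℝ} (hp : 0 < p) {x : Space N} (hr : 0 < r)
    (hx : ‖x‖ ≤ r) : |eulerDiv p r x| ≤ (N + p) * r ^ (-p) := by
  have h1 := mul_le_mul_of_nonneg_left (sq_mul_rpow_le (p := p) hr (norm_nonneg x) hx) hp.le
  have h2 : 0 ≤ p * (‖x‖ ^ 2 * r ^ (-p - 2)) := by positivity
  have h3 : 0 ≤ N * r ^ (-p) := by positivity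
  have h4 : 0 ≤ p * r ^ (-p) := by positivity
  rw [eulerDiv, abs_le]
  constructor <;> linarith

/-- Young's inequality for `T * ‖s‖` and `‖ξ‖`: the bound on `F` makes the mixed term at most `p (T
‖s‖)^{p-1} ‖ξ‖`, which `‖ξ‖^p` and `(p - 1) (T ‖s‖)^p` absorb. -/
theorem density_nonneg {E : Type*} [NormedAddCommGroup E] [InnerProductSpace ℝ E] {p : ℝ}
    (hp : 1 < p) {T m s : ℝ} {F ξ : E} (hT : 0 ≤ T) (hF : ‖F‖ ≤ p * T ^ (p - 1))
    (hm : (p - 1) * T ^ p ≤ m) : 0 ≤ density p 1 F m s ξ := by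
  have h1 := mul_rpow_sub_one_mul_le hp (mul_nonneg hT (norm_nonneg s)) (norm_nonneg ξ)
  rw [Real.mul_rpow hT (norm_nonneg s), Real.mul_rpow hT (norm_nonneg s)] at h1
  have h2 : |powMap p s * inner ℝ F ξ| ≤ ‖s‖ ^ (p - 1) * (p * T ^ (p - 1) * ‖ξ‖) := by
    rw [abs_mul, ← Real.norm_eq_abs (powMap p s), norm_powMap hp]
    gcongr
    exact (abs_real_inner_le_norm F ξ).trans (by gcongr)
  have h3 := (abs_le.1 h2).1
  have h4 : (p - 1) * T ^ p * ‖s‖ ^ p ≤ m * ‖s‖ ^ p := by gcongr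
  rw [density]
  linarith

variable {N : ℕ} {Ω : Set (Space N)} {p : ℝ}

theorem fderiv_norm_rpow_mul_regNorm (hp : 1 < p) {ε : ℝ} (hε : 0 < ε) {φ : Space N → ℝ}
    (hφ : Differentiable ℝ φ) (x : Space N) :
    fderiv ℝ (fun x => ‖φ x‖ ^ p * regNorm ε x ^ (-p)) x x =
      powMap p (φ x) * inner ℝ (eulerField p (regNorm ε x) x) (gradient φ x)
        - p * (‖x‖ ^ 2 * regNorm ε x ^ (-p - 2)) * ‖φ x‖ ^ p := by
  have h1 := (hasFDerivAt_norm_rpow (φ x) hp).comp x (hφ x).hasFDerivAt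
  have h2 : HasFDerivAt (fun y : Space N => ‖y‖ ^ 2 + ε) (2 • innerSL ℝ x) x :=
    (hasStrictFDerivAt_norm_sq x).hasFDerivAt.add_const ε
  have h3 := h2.rpow_const (p := -p / 2) (Or.inl (by positivity))
  have h4 : (fun y : Space N => ‖φ y‖ ^ p * regNorm ε y ^ (-p)) =
      fun y => ‖φ y‖ ^ p * (‖y‖ ^ 2 + ε) ^ (-p / 2) := by
    funext y
    rw [regNorm_rpow hε]
  have h5 : inner ℝ x (gradient φ x) = fderiv ℝ φ x x := by
    rw [real_inner_comm, gradient, InnerProductSpace.toDual_symm_apply]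
  have h6 : HasFDerivAt (fun y : Space N => ‖φ y‖ ^ p * (‖y‖ ^ 2 + ε) ^ (-p / 2)) _ x := h1.mul h3
  rw [h4, h6.fderiv, regNorm_rpow hε, eulerField, inner_smul_left, h5, regNorm_rpow hε]
  have h7 : (-p - 2) / 2 = -p / 2 - 1 := by ring
  simp only [add_apply, smul_apply, ContinuousLinearMap.comp_apply,
    innerSL_apply_apply, smul_eq_mul, real_inner_self_eq_norm_sq, powMap, h7, Function.comp_apply,
    conj_trivial, nsmul_eq_mul]
  simp
  ring

variable [hp : Fact (1 < p)]

theorem isCoeff_euler {ε : ℝ} (hε : 0 < ε) (μ : Measure (Space N)) : IsCoeff μ (fun _ => (0 : ℝ))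
    (fun x => eulerField p (regNorm ε x) x) (fun x => eulerDiv p (regNorm ε x) x)
    (p * (√ε)⁻¹ ^ (p - 1) + (N + p) * √ε ^ (-p)) := by
  have hp0 : 0 < p := by linarith [hp.out]
  have hp1 : 0 ≤ p - 1 := by linarith [hp.out]
  have hs := Real.sqrt_pos.2 hε
  have h1 : 0 ≤ p * (√ε)⁻¹ ^ (p - 1) := by positivity
  have h2 : 0 ≤ (N + p) * √ε ^ (-p) := by positivity
  have h0 := continuous_regNorm_rpow (N := N) hε
  refine ⟨aestronglyMeasurable_const, ?_, ?_, fun x => ?_, fun x => ?_, fun x => ?_⟩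
  · exact ((continuous_const.mul (h0 _)).smul continuous_id).aestronglyMeasurable
  · exact ((continuous_const.mul (h0 _)).sub (continuous_const.mul
      ((continuous_norm.pow 2).mul (h0 _)))).aestronglyMeasurable
  · rw [abs_zero]
    positivity
  · refine (norm_eulerField_le hp0 (regNorm_pos hε x) (norm_le_regNorm hε.le x)).trans ?_
    have := regNorm_pos hε x
    have : p * (regNorm ε x)⁻¹ ^ (p - 1) ≤ p * (√ε)⁻¹ ^ (p - 1) := by
      gcongr
      exact sqrt_le_regNorm x
    linarith
  · refine (abs_eulerDiv_le hp0 (regNorm_pos hε x) (norm_le_regNorm hε.le x)).trans ?_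
    have : (N + p) * regNorm ε x ^ (-p) ≤ (N + p) * √ε ^ (-p) :=
      mul_le_mul_of_nonneg_left (Real.rpow_le_rpow_of_nonpos hs (sqrt_le_regNorm x)
        (by linarith)) (by positivity)
    linarith

/-- For a test function the integrand is the divergence of the compactly supported field `|φ|^p
r^{-p} x`. The identity passes to the closure because `ε > 0` keeps the coefficients bounded and
hence the functional continuous. -/
theorem functional_euler_eq_zero {ε : ℝ} (hε : 0 < ε) (u : sobolevZero Ω p) :
    functional (fun _ => (0 : ℝ)) (fun x => eulerField p (regNorm ε x) x)
      (fun x => eulerDiv p (regNorm ε x) x) u.1 = 0 := by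
  refine sobolevZero_induction (isClosed_eq
    (isCoeff_euler hε (volume.restrict Ω)).continuous_functional continuous_const) ?_ u
  intro φ w hφ h1 h2
  have hp0 : 0 < p := by linarith [hp.out]
  set ψ : Space N → ℝ := fun x => ‖φ x‖ ^ p * regNorm ε x ^ (-p) with hψ
  have hψs : HasCompactSupport ψ := by
    have : HasCompactSupport fun x => ‖φ x‖ ^ p := by
      refine hφ.compact.comp_left (g := fun t : ℝ => ‖t‖ ^ p) ?_
      simp [hp0.ne']
    exact this.mul_right
  have hψc : ContDiff ℝ 1 ψ := by
    refine ((hφ.smooth.of_le (by simp)).norm_rpow hp.out).mul ?_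
    have : ContDiff ℝ 1 fun x : Space N => (‖x‖ ^ 2 + ε) ^ (-p / 2) :=
      ((contDiff_norm_sq ℝ).add contDiff_const).rpow_const_of_ne
        fun x => (by positivity : ‖x‖ ^ 2 + ε ≠ 0)
    simpa only [regNorm_rpow hε] using this
  have hI := integral_fderiv_apply_self hψc hψs
  have hfi : Integrable fun x => fderiv ℝ ψ x x := by
    refine (((hψc.continuous_fderiv one_ne_zero).clm_apply
      continuous_id)).integrable_of_hasCompactSupport ?_
    refine (hψs.fderiv (𝕜 := ℝ)).mono fun x hx => ?_
    simp only [Function.mem_support] at hx ⊢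
    intro h
    simp [h] at hx
  have hψi := hψc.continuous.integrable_of_hasCompactSupport (μ := volume) hψs
  have hd := hφ.smooth.differentiable (by simp)
  calc functional (fun _ => (0 : ℝ)) (fun x => eulerField p (regNorm ε x) x)
        (fun x => eulerDiv p (regNorm ε x) x) w
      = ∫ x in Ω, (fderiv ℝ ψ x x + N * ψ x) := by
        apply integral_congr_ae
        filter_upwards [h1, h2] with x e1 e2
        rw [e1, e2, hψ, fderiv_norm_rpow_mul_regNorm hp.out hε hd, density, eulerDiv]
        ring
    -- Off `Ω` the test function vanishes, and with it both terms, so the integral may be taken over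
    -- the whole space.
    _ = ∫ x, (fderiv ℝ ψ x x + N * ψ x) := by
        refine setIntegral_eq_integral_of_forall_compl_eq_zero fun x hx => ?_
        have h0 : φ x = 0 := image_eq_zero_of_notMem_tsupport fun h => hx (hφ.support_subset h)
        rw [hψ, fderiv_norm_rpow_mul_regNorm hp.out hε hd, h0]
        simp [powMap, hp0.ne', h0]
    _ = 0 := by
        rw [integral_add hfi (hψi.const_mul _), hI, integral_const_mul]
        ring

end EulerField

/-! ### Hardy's inequality with its deficit, and the Poincaré inequality. -/

section Hardy

variable {N : ℕ} {Ω : Set (Space N)} {p : ℝ} [hp : Fact (1 < p)]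

theorem inv_rpow_eq_rpow_neg {r : ℝ} (hr : 0 ≤ r) (t : ℝ) : r⁻¹ ^ t = r ^ (-t) := by
  rw [Real.inv_rpow hr, Real.rpow_neg hr]

/-- Adding `a^{p-1}` times the vanishing divergence integral completes `‖∇u‖^p - a^p r^{-p} |u|^p`
to a density that is nonnegative by `density_nonneg` with `T = a / r`. The condition `p * a ≤ N - p`
is what makes the coefficient of `|u|^p` at least `(p - 1) T^p`. -/
theorem hardy_regNorm {a : ℝ} (ha : 0 ≤ a) (haN : p * a ≤ N - p) {ε : ℝ} (hε : 0 < ε)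
    (u : sobolevZero Ω p) :
    Integrable (fun x => regNorm ε x ^ (-p) * ‖fn u x‖ ^ p) (volume.restrict Ω) ∧
    a ^ p * ∫ x in Ω, regNorm ε x ^ (-p) * ‖fn u x‖ ^ p ≤ ‖grad u‖ ^ p := by
  have hp0 : 0 < p := by linarith [hp.out]
  have i1 : Integrable (fun x => regNorm ε x ^ (-p) * ‖fn u x‖ ^ p) (volume.restrict Ω) := by
    refine Integrable.mono' ((Lp.integrable_norm_rpow (fn u)).const_mul (√ε ^ (-p)))
      ((continuous_regNorm_rpow hε _).aestronglyMeasurable.mul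
        (Lp.integrable_norm_rpow (fn u)).aestronglyMeasurable)
      (Filter.Eventually.of_forall fun x => ?_)
    have h1 := regNorm_pos hε x
    rw [Real.norm_of_nonneg (by positivity)]
    refine mul_le_mul_of_nonneg_right (Real.rpow_le_rpow_of_nonpos (Real.sqrt_pos.2 hε)
      (sqrt_le_regNorm x) (by linarith)) (by positivity)
  refine ⟨i1, ?_⟩
  have i2 := Lp.integrable_norm_rpow (grad u)
  have i3 := (isCoeff_euler (N := N) (p := p) hε (volume.restrict Ω)).integrable_density u.1
  have h0 : ∫ x in Ω, density p 0 (eulerField p (regNorm ε x) x) (eulerDiv p (regNorm ε x) x)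
    (u.1.1 x) (u.1.2 x) = 0 := functional_euler_eq_zero hε u
  have key : ∀ x : Space N, 0 ≤ ‖grad u x‖ ^ p + a ^ (p - 1) * density p 0
      (eulerField p (regNorm ε x) x) (eulerDiv p (regNorm ε x) x) (u.1.1 x) (u.1.2 x)
      - a ^ p * (regNorm ε x ^ (-p) * ‖fn u x‖ ^ p) := by
    intro x
    have hr := regNorm_pos hε x
    have hxr := norm_le_regNorm hε.le x
    have hap : a ^ p = a ^ (p - 1) * a := by
      rw [← Real.rpow_add_one' ha (by linarith)]
      ring_nf
    have h1 := density_nonneg hp.out (T := a * (regNorm ε x)⁻¹) (s := fn u x) (ξ := grad u x)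
      (F := a ^ (p - 1) • eulerField p (regNorm ε x) x)
      (m := a ^ (p - 1) * eulerDiv p (regNorm ε x) x - a ^ p * regNorm ε x ^ (-p))
      (by positivity)
      (by
        rw [norm_smul, Real.norm_of_nonneg (by positivity), Real.mul_rpow ha (by positivity)]
        have := mul_le_mul_of_nonneg_left (norm_eulerField_le hp0 hr hxr)
          (by positivity : 0 ≤ a ^ (p - 1))
        linarith)
      (by
        rw [Real.mul_rpow ha (by positivity), inv_rpow_eq_rpow_neg hr.le, hap]
        have h2 := mul_le_mul_of_nonneg_left (le_eulerDiv hp0 hr hxr)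
          (by positivity : 0 ≤ a ^ (p - 1))
        have h3 := mul_le_mul_of_nonneg_right haN
          (by positivity : 0 ≤ a ^ (p - 1) * regNorm ε x ^ (-p))
        linarith)
    refine h1.trans_eq ?_
    simp only [density, inner_smul_left, conj_trivial, fn, grad]
    ring
  have h1 : (0 : ℝ) ≤ ∫ x in Ω, (‖grad u x‖ ^ p + a ^ (p - 1) * density p 0
      (eulerField p (regNorm ε x) x) (eulerDiv p (regNorm ε x) x) (u.1.1 x) (u.1.2 x)
      - a ^ p * (regNorm ε x ^ (-p) * ‖fn u x‖ ^ p)) := integral_nonneg key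
  have i4 : Integrable (fun x => ‖grad u x‖ ^ p + a ^ (p - 1) * density p 0
      (eulerField p (regNorm ε x) x) (eulerDiv p (regNorm ε x) x) (u.1.1 x) (u.1.2 x))
      (volume.restrict Ω) := i2.add (i3.const_mul _)
  rw [integral_sub i4 (i1.const_mul _), integral_add i2 (i3.const_mul _), integral_const_mul, h0,
    integral_const_mul, ← norm_rpow_eq_integral] at h1
  linarith

theorem ae_ne_zero (hN : 0 < N) (μ : Measure (Space N)) (hμ : μ ≪ volume) :
    ∀ᵐ x ∂μ, x ≠ 0 := by
  have : Nonempty (Fin N) := ⟨⟨0, hN⟩⟩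
  have : Nontrivial (Space N) := inferInstance
  have h : ∀ᵐ x ∂(volume : Measure (Space N)), x ≠ 0 := by
    rw [ae_iff]
    simp
  exact hμ.ae_le h

/-- Fatou's lemma as `ε → 0`, which also yields the membership of `u / |x|` in `L^p`. -/
theorem hardy {a : ℝ} (ha : 0 < a) (haN : p * a ≤ N - p) (u : sobolevZero Ω p) :
    MemLp (fun x => ‖x‖⁻¹ * fn u x) (ENNReal.ofReal p) (volume.restrict Ω) ∧
    a ^ p * ∫ x in Ω, ‖‖x‖⁻¹ * fn u x‖ ^ p ≤ ‖grad u‖ ^ p := by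
  have hp0 : 0 < p := by linarith [hp.out]
  have hN : 0 < N := by
    have : (0 : ℝ) < N := by nlinarith
    exact_mod_cast this
  have hae := ae_ne_zero hN (volume.restrict Ω) Measure.absolutelyContinuous_restrict
  have hap : 0 < a ^ p := by positivity
  have hm : AEStronglyMeasurable (fun x => ‖x‖⁻¹ * fn u x) (volume.restrict Ω) :=
    (measurable_norm.inv.aestronglyMeasurable).mul (Lp.aestronglyMeasurable _)
  have hmp : AEStronglyMeasurable (fun x => ‖‖x‖⁻¹ * fn u x‖ ^ p) (volume.restrict Ω) :=
    (continuous_id.rpow_const fun _ => Or.inr hp0.le : Continuous fun t : ℝ => t ^ p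
      ).comp_aestronglyMeasurable hm.norm
  let e : ℕ → ℝ := fun n => 1 / ((n : ℝ) + 1)
  have he : ∀ n, 0 < e n := fun n => by positivity
  have hle : ∫⁻ x in Ω, ENNReal.ofReal (‖‖x‖⁻¹ * fn u x‖ ^ p)
      ≤ ENNReal.ofReal (‖grad u‖ ^ p / a ^ p) := by
    have h1 : ∀ᵐ x ∂(volume.restrict Ω), Filter.Tendsto (fun n => ENNReal.ofReal
        (regNorm (e n) x ^ (-p) * ‖fn u x‖ ^ p)) Filter.atTop
        (nhds (ENNReal.ofReal (‖‖x‖⁻¹ * fn u x‖ ^ p))) := by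
      filter_upwards [hae] with x hx
      rw [norm_mul, Real.mul_rpow (norm_nonneg _) (norm_nonneg _), norm_inv, norm_norm,
        inv_rpow_eq_rpow_neg (norm_nonneg x)]
      exact (ENNReal.continuous_ofReal.tendsto _).comp
        ((tendsto_regNorm_rpow x hx (-p)).mul_const _)
    calc ∫⁻ x in Ω, ENNReal.ofReal (‖‖x‖⁻¹ * fn u x‖ ^ p)
        = ∫⁻ x in Ω, Filter.liminf (fun n => ENNReal.ofReal
          (regNorm (e n) x ^ (-p) * ‖fn u x‖ ^ p)) Filter.atTop := by
          apply lintegral_congr_ae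
          filter_upwards [h1] with x hx
          exact hx.liminf_eq.symm
      _ ≤ Filter.liminf (fun n => ∫⁻ x in Ω, ENNReal.ofReal
          (regNorm (e n) x ^ (-p) * ‖fn u x‖ ^ p)) Filter.atTop :=
          lintegral_liminf_le' fun n =>
            (hardy_regNorm ha.le haN (he n) u).1.aestronglyMeasurable.aemeasurable.ennreal_ofReal
      _ ≤ ENNReal.ofReal (‖grad u‖ ^ p / a ^ p) := by
          refine Filter.liminf_le_of_le ⟨0, by simp⟩ fun b hb => ?_
          obtain ⟨n, hn⟩ := hb.exists
          refine hn.trans ?_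
          obtain ⟨i, hi⟩ := hardy_regNorm ha.le haN (he n) u
          rw [← ofReal_integral_eq_lintegral_ofReal i (Filter.Eventually.of_forall fun x => by
            have := regNorm_pos (he n) x
            simp only [Pi.zero_apply]
            positivity)]
          apply ENNReal.ofReal_le_ofReal
          rw [le_div_iff₀ hap]
          linarith
  have hi : Integrable (fun x => ‖‖x‖⁻¹ * fn u x‖ ^ p) (volume.restrict Ω) := by
    refine ⟨hmp, ?_⟩
    rw [hasFiniteIntegral_iff_ofReal (Filter.Eventually.of_forall fun x => by
      simp only [Pi.zero_apply]
      positivity)]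
    exact hle.trans_lt ENNReal.ofReal_lt_top
  refine ⟨memLp_ofReal_of_integrable hp.out hm hi, ?_⟩
  rw [← ofReal_integral_eq_lintegral_ofReal hi (Filter.Eventually.of_forall fun x => by
      simp only [Pi.zero_apply]
      positivity), ENNReal.ofReal_le_ofReal_iff (by positivity), le_div_iff₀ hap] at hle
  linarith

/-- A dominating function uniform in the regularisation, integrable by Hardy's inequality: Young's
inequality contributes `p - 1` and the divergence `N + p`. -/
theorem abs_density_euler_le {r s : ℝ} {x ξ : Space N} (hx : x ≠ 0) (hxr : ‖x‖ ≤ r) :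
    |density p 0 (eulerField p r x) (eulerDiv p r x) s ξ|
      ≤ ‖ξ‖ ^ p + (N + p + (p - 1)) * ‖‖x‖⁻¹ * s‖ ^ p := by
  have hp0 : 0 < p := by linarith [hp.out]
  have hx0 : 0 < ‖x‖ := norm_pos_iff.2 hx
  have hr : 0 < r := hx0.trans_le hxr
  have hv : ‖‖x‖⁻¹ * s‖ = ‖x‖⁻¹ * ‖s‖ := by
    rw [norm_mul, norm_inv, norm_norm]
  have hinv : r⁻¹ ≤ ‖x‖⁻¹ := inv_anti₀ hx0 hxr
  have h1 := mul_rpow_sub_one_mul_le hp.out (norm_nonneg (‖x‖⁻¹ * s)) (norm_nonneg ξ)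
  have h2 : |powMap p s * inner ℝ (eulerField p r x) ξ|
      ≤ p * (‖‖x‖⁻¹ * s‖ ^ (p - 1) * ‖ξ‖) := by
    rw [abs_mul, ← Real.norm_eq_abs (powMap p s), norm_powMap hp.out, hv,
      Real.mul_rpow (by positivity) (norm_nonneg s)]
    have h3 : |inner ℝ (eulerField p r x) ξ| ≤ p * ‖x‖⁻¹ ^ (p - 1) * ‖ξ‖ := by
      refine (abs_real_inner_le_norm _ ξ).trans ?_
      gcongr
      refine (norm_eulerField_le hp0 hr hxr).trans ?_
      have : 0 ≤ p - 1 := by linarith [hp.out]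
      gcongr
    have := mul_le_mul_of_nonneg_left h3 (by positivity : 0 ≤ ‖s‖ ^ (p - 1))
    linarith
  have h3 : |eulerDiv p r x * ‖s‖ ^ p| ≤ (N + p) * ‖‖x‖⁻¹ * s‖ ^ p := by
    rw [abs_mul, abs_of_nonneg (by positivity : 0 ≤ ‖s‖ ^ p), hv,
      Real.mul_rpow (by positivity) (norm_nonneg s), ← mul_assoc]
    refine mul_le_mul_of_nonneg_right ((abs_eulerDiv_le hp0 hr hxr).trans ?_) (by positivity)
    rw [← inv_rpow_eq_rpow_neg hr.le]
    gcongr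
  rw [density, zero_mul, zero_add]
  have := abs_add_le (powMap p s * inner ℝ (eulerField p r x) ξ) (eulerDiv p r x * ‖s‖ ^ p)
  linarith

/-- Dominated convergence in the regularised identity; test functions need not vanish near the
origin, so the singular field is reached only as a limit. -/
theorem integral_density_euler_eq_zero (hpN : p < N) (u : sobolevZero Ω p) :
    Integrable (fun x => density p 0 (eulerField p ‖x‖ x) (eulerDiv p ‖x‖ x) (fn u x) (grad u x))
      (volume.restrict Ω) ∧
    ∫ x in Ω, density p 0 (eulerField p ‖x‖ x) (eulerDiv p ‖x‖ x) (fn u x) (grad u x) = 0 := by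
  have hp0 : 0 < p := by linarith [hp.out]
  have hN : 0 < N := by
    have : (0 : ℝ) < N := by linarith
    exact_mod_cast this
  have hae := ae_ne_zero hN (volume.restrict Ω) Measure.absolutelyContinuous_restrict
  obtain ⟨hv, -⟩ := hardy (a := (N - p) / p) (div_pos (by linarith) hp0)
    (mul_div_cancel₀ _ hp0.ne').le u
  let e : ℕ → ℝ := fun n => 1 / ((n : ℝ) + 1)
  have he : ∀ n, 0 < e n := fun n => by positivity
  have hb : Integrable (fun x => ‖grad u x‖ ^ p + (N + p + (p - 1)) * ‖‖x‖⁻¹ * fn u x‖ ^ p)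
      (volume.restrict Ω) :=
    (Lp.integrable_norm_rpow (grad u)).add ((hv.integrable_norm_rpow_ofReal hp.out).const_mul _)
  have hmeas := fun n => ((isCoeff_euler (N := N) (p := p) (he n)
    (volume.restrict Ω)).integrable_density u.1).aestronglyMeasurable
  have hlim : ∀ᵐ x ∂(volume.restrict Ω), Filter.Tendsto (fun n => density p 0
      (eulerField p (regNorm (e n) x) x) (eulerDiv p (regNorm (e n) x) x) (fn u x) (grad u x))
      Filter.atTop (nhds (density p 0 (eulerField p ‖x‖ x) (eulerDiv p ‖x‖ x) (fn u x)
        (grad u x))) := by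
    filter_upwards [hae] with x hx
    have t := tendsto_regNorm_rpow x hx
    refine (tendsto_const_nhds.add (tendsto_const_nhds.mul ?_)).add (Filter.Tendsto.mul_const _ ?_)
    · exact (((t (-p)).const_mul p).smul_const x).inner tendsto_const_nhds
    · exact ((t (-p)).const_mul _).sub (((t (-p - 2)).const_mul _).const_mul p)
  have hbd : ∀ n, ∀ᵐ x ∂(volume.restrict Ω), ‖density p 0
      (eulerField p (regNorm (e n) x) x) (eulerDiv p (regNorm (e n) x) x) (fn u x) (grad u x)‖
      ≤ ‖grad u x‖ ^ p + (N + p + (p - 1)) * ‖‖x‖⁻¹ * fn u x‖ ^ p := by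
    intro n
    filter_upwards [hae] with x hx
    exact abs_density_euler_le hx (norm_le_regNorm (he n).le x)
  refine ⟨Integrable.mono' hb (aestronglyMeasurable_of_tendsto_ae _ hmeas hlim) ?_, ?_⟩
  · filter_upwards [hae] with x hx
    exact abs_density_euler_le hx le_rfl
  · refine tendsto_nhds_unique (tendsto_integral_of_dominated_convergence _ hmeas hb hbd hlim)
      (tendsto_const_nhds.congr fun n => ?_)
    exact (functional_euler_eq_zero (he n) u).symm

/-- The integrand of `∫ |∇u|^p - a^p |u|^p / |x|^p` after completing it, by an integration by
parts, to a pointwise nonnegative expression which is convex in `∇u`. -/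
noncomputable def hardyDensity (p a : ℝ) (x : Space N) (s : ℝ) (ξ : Space N) : ℝ :=
  density p 1 (a ^ (p - 1) • eulerField p ‖x‖ x) ((p - 1) * (a ^ p * ‖x‖ ^ (-p))) s ξ

theorem hardyDensity_nonneg {a : ℝ} (ha : 0 ≤ a) (x : Space N) (s : ℝ) (ξ : Space N) :
    0 ≤ hardyDensity p a x s ξ := by
  have hp0 : 0 < p := by linarith [hp.out]
  have hp1 : 0 ≤ p - 1 := by linarith [hp.out]
  refine density_nonneg hp.out (T := a * ‖x‖⁻¹) (by positivity) ?_ ?_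
  · rw [norm_smul, Real.norm_of_nonneg (by positivity), Real.mul_rpow ha (by positivity)]
    rcases eq_or_ne x 0 with rfl | hx
    · simp only [eulerField, smul_zero, norm_zero, mul_zero]
      positivity
    · have := mul_le_mul_of_nonneg_left (norm_eulerField_le hp0 (norm_pos_iff.2 hx) le_rfl)
          (by positivity : 0 ≤ a ^ (p - 1))
      linarith
  · rw [Real.mul_rpow ha (by positivity), inv_rpow_eq_rpow_neg (norm_nonneg x)]

/-- The key identity: at the critical constant the Hardy deficit equals the integral of a
nonnegative density convex in the gradient. -/
theorem integral_hardyDensity (hpN : p < N) (u : sobolevZero Ω p) :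
    Integrable (fun x => hardyDensity p ((N - p) / p) x (fn u x) (grad u x))
      (volume.restrict Ω) ∧
    ∫ x in Ω, hardyDensity p ((N - p) / p) x (fn u x) (grad u x) =
      ‖grad u‖ ^ p - ((N - p) / p) ^ p * ∫ x in Ω, ‖‖x‖⁻¹ * fn u x‖ ^ p := by
  have hp0 : 0 < p := by linarith [hp.out]
  have hN : 0 < N := by
    have : (0 : ℝ) < N := by linarith
    exact_mod_cast this
  have hae := ae_ne_zero hN (volume.restrict Ω) Measure.absolutelyContinuous_restrict
  set a : ℝ := (N - p) / p with ha_def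
  have ha : 0 < a := div_pos (by linarith) hp0
  have haN : p * a = N - p := mul_div_cancel₀ _ hp0.ne'
  obtain ⟨hv, -⟩ := hardy ha haN.le u
  have i1 := Lp.integrable_norm_rpow (grad u)
  have i2 := hv.integrable_norm_rpow_ofReal hp.out
  obtain ⟨i3, h3⟩ := integral_density_euler_eq_zero hpN u
  have i4 : Integrable (fun x => ‖grad u x‖ ^ p + a ^ (p - 1) * density p 0 (eulerField p ‖x‖ x)
      (eulerDiv p ‖x‖ x) (fn u x) (grad u x)) (volume.restrict Ω) := i1.add (i3.const_mul _)
  have hap : a ^ p = a ^ (p - 1) * a := by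
    rw [← Real.rpow_add_one' ha.le (by linarith)]
    ring_nf
  have heq : (fun x => hardyDensity p a x (fn u x) (grad u x)) =ᵐ[volume.restrict Ω]
      fun x => ‖grad u x‖ ^ p + a ^ (p - 1) * density p 0 (eulerField p ‖x‖ x)
      (eulerDiv p ‖x‖ x) (fn u x) (grad u x) - a ^ p * ‖‖x‖⁻¹ * fn u x‖ ^ p := by
    filter_upwards [hae] with x hx
    have h1 : ‖x‖ ^ (-p) = ‖x‖ ^ 2 * ‖x‖ ^ (-p - 2) := by
      rw [← Real.rpow_natCast, ← Real.rpow_add (norm_pos_iff.2 hx)]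
      norm_num
    have h2 : ‖‖x‖⁻¹ * fn u x‖ ^ p = ‖x‖ ^ (-p) * ‖fn u x‖ ^ p := by
      rw [norm_mul, Real.mul_rpow (norm_nonneg _) (norm_nonneg _), norm_inv, norm_norm,
        inv_rpow_eq_rpow_neg (norm_nonneg x)]
    -- Without regularisation the divergence is `(N - p) |x|^{-p}`, so the zeroth order coefficient
    -- is `p a^p - a^p = (p - 1) a^p` times `|x|^{-p}`.
    have h4 : eulerDiv p ‖x‖ x = p * a * ‖x‖ ^ (-p) := by
      rw [eulerDiv, ← h1, haN]
      ring
    rw [hardyDensity, density, density, h2, h4, hap, inner_smul_left, conj_trivial]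
    ring
  refine ⟨(i4.sub (i2.const_mul _)).congr heq.symm, ?_⟩
  rw [integral_congr_ae heq, integral_sub i4 (i2.const_mul _), integral_add i1 (i3.const_mul _),
    integral_const_mul, h3, integral_const_mul, ← norm_rpow_eq_integral]
  ring

/-- The Poincaré inequality. -/
theorem exists_norm_fn_le (hpN : p < N) (hΩ : MeasurableSet Ω) (hΩb : Bornology.IsBounded Ω) :
    ∃ C : ℝ, 0 ≤ C ∧ ∀ u : sobolevZero Ω p, ‖fn u‖ ≤ C * ‖grad u‖ := by
  have hp0 : 0 < p := by linarith [hp.out]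
  have hN : 0 < N := by
    have : (0 : ℝ) < N := by linarith
    exact_mod_cast this
  have hae := ae_ne_zero hN (volume.restrict Ω) Measure.absolutelyContinuous_restrict
  set a : ℝ := (N - p) / p with ha_def
  have ha : 0 < a := div_pos (by linarith) hp0
  have haN : p * a = N - p := mul_div_cancel₀ _ hp0.ne'
  obtain ⟨R, hR0, hR⟩ := hΩb.exists_pos_norm_le
  -- On `Ω` one has `|x| ≤ R`, so `|u| ≤ R |u| / |x|` almost everywhere, and Hardy's inequality
  -- gives `R / a`.
  refine ⟨R / a, by positivity, fun u => ?_⟩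
  obtain ⟨hv, hH⟩ := hardy ha haN.le u
  have i2 := hv.integrable_norm_rpow_ofReal hp.out
  have h1 : ‖fn u‖ ^ p ≤ R ^ p * ∫ x in Ω, ‖‖x‖⁻¹ * fn u x‖ ^ p := by
    rw [norm_rpow_eq_integral, ← integral_const_mul]
    refine integral_mono_ae (Lp.integrable_norm_rpow (fn u)) (i2.const_mul _) ?_
    filter_upwards [hae, ae_restrict_mem hΩ] with x hx hxΩ
    have hx0 : 0 < ‖x‖ := norm_pos_iff.2 hx
    rw [← Real.mul_rpow hR0.le (norm_nonneg _), norm_mul, norm_inv, norm_norm]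
    gcongr
    rw [← mul_assoc]
    refine le_mul_of_one_le_left (norm_nonneg _) ?_
    rw [← div_eq_mul_inv, one_le_div hx0]
    exact hR x hxΩ
  refine (Real.rpow_le_rpow_iff (norm_nonneg _) (by positivity) hp0).1 ?_
  rw [Real.mul_rpow (by positivity) (norm_nonneg _), Real.div_rpow hR0.le ha.le]
  have hap : 0 < a ^ p := by positivity
  rw [div_mul_eq_mul_div, le_div_iff₀ hap]
  calc ‖fn u‖ ^ p * a ^ p ≤ (R ^ p * ∫ x in Ω, ‖‖x‖⁻¹ * fn u x‖ ^ p) * a ^ p := by gcongr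
    _ = R ^ p * (a ^ p * ∫ x in Ω, ‖‖x‖⁻¹ * fn u x‖ ^ p) := by ring
    _ ≤ R ^ p * ‖grad u‖ ^ p := by gcongr

end Hardy

/-! ### Compactness of the embedding into `L^p` by local averages. -/

section Rellich

variable {N : ℕ} {Ω : Set (Space N)} {p : ℝ}

theorem norm_gradient (φ : Space N → ℝ) (x : Space N) : ‖gradient φ x‖ = ‖fderiv ℝ φ x‖ := by
  rw [gradient, LinearIsometryEquiv.norm_map]

theorem continuous_ofReal_norm_rpow (hp : 0 ≤ p) {X F : Type*} [TopologicalSpace X]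
    [NormedAddCommGroup F] {f : X → F} (hf : Continuous f) :
    Continuous fun x => ENNReal.ofReal (‖f x‖ ^ p) :=
  ENNReal.continuous_ofReal.comp (hf.norm.rpow_const fun _ => Or.inr hp)

/-- The fundamental theorem of calculus along the segment, then Jensen's inequality for `|·|^p`. -/
theorem ofReal_norm_sub_rpow_le (hp : 1 < p) {φ : Space N → ℝ} (hφ : ContDiff ℝ 1 φ)
    (x h : Space N) : ENNReal.ofReal (‖φ (x + h) - φ x‖ ^ p) ≤ ENNReal.ofReal (‖h‖ ^ p) *
      ∫⁻ t in Set.Ioc (0 : ℝ) 1, ENNReal.ofReal (‖gradient φ (x + t • h)‖ ^ p) := by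
  have hp0 : 0 < p := by linarith
  have hd : Differentiable ℝ φ := hφ.differentiable one_ne_zero
  have hline : Continuous fun t : ℝ => x + t • h := by fun_prop
  have hcd : Continuous fun t : ℝ => fderiv ℝ φ (x + t • h) h :=
    ((hφ.continuous_fderiv one_ne_zero).comp hline).clm_apply continuous_const
  have hcg : Continuous fun t : ℝ => gradient φ (x + t • h) :=
    (LinearIsometryEquiv.continuous _).comp ((hφ.continuous_fderiv one_ne_zero).comp hline)
  have hrp : Continuous fun t : ℝ => t ^ p := continuous_id.rpow_const fun _ => Or.inr hp0.le
  have hftc : φ (x + h) - φ x = ∫ t in Set.Ioc (0 : ℝ) 1, fderiv ℝ φ (x + t • h) h := by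
    rw [← intervalIntegral.integral_of_le zero_le_one,
      intervalIntegral.integral_eq_sub_of_hasDerivAt (f := fun t : ℝ => φ (x + t • h))
      (fun t _ => ?_) (hcd.intervalIntegrable _ _)]
    · simp
    · have h1 : HasDerivAt (fun t : ℝ => x + t • h) h t := by
        simpa using ((hasDerivAt_id t).smul_const h).const_add x
      exact (hd (x + t • h)).hasFDerivAt.comp_hasDerivAt t h1
  have : IsProbabilityMeasure ((volume : Measure ℝ).restrict (Set.Ioc 0 1)) := ⟨by simp⟩
  have hii : ∀ f : ℝ → ℝ, Continuous f → Integrable f (volume.restrict (Set.Ioc (0 : ℝ) 1)) :=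
    fun f hf => (hf.integrableOn_Icc (a := 0) (b := 1)).mono_set Set.Ioc_subset_Icc_self
  have hJ := (convexOn_norm_rpow (E := ℝ) hp.le).map_integral_le
    (μ := (volume : Measure ℝ).restrict (Set.Ioc 0 1)) (f := fun t => fderiv ℝ φ (x + t • h) h)
    (hrp.comp continuous_norm).continuousOn isClosed_univ (by simp) (hii _ hcd)
    (hii _ (hrp.comp hcd.norm))
  have hle : ‖φ (x + h) - φ x‖ ^ p ≤
      ‖h‖ ^ p * ∫ t in Set.Ioc (0 : ℝ) 1, ‖gradient φ (x + t • h)‖ ^ p := by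
    rw [hftc]
    refine hJ.trans ?_
    rw [← integral_const_mul]
    refine integral_mono (hii _ (hrp.comp hcd.norm))
      ((hii _ (hrp.comp hcg.norm)).const_mul _) fun t => ?_
    simp only
    rw [← Real.mul_rpow (norm_nonneg _) (norm_nonneg _), norm_gradient, mul_comm]
    gcongr
    exact ContinuousLinearMap.le_opNorm _ _
  have hig : Integrable (fun t : ℝ => ‖gradient φ (x + t • h)‖ ^ p)
      (volume.restrict (Set.Ioc (0 : ℝ) 1)) := hii _ (hrp.comp hcg.norm)
  refine (ENNReal.ofReal_le_ofReal hle).trans_eq ?_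
  rw [ENNReal.ofReal_mul (by positivity), ofReal_integral_eq_lintegral_ofReal hig
    (Filter.Eventually.of_forall fun t => by
      simp only [Pi.zero_apply]
      positivity)]

/-- Tonelli's theorem and translation invariance applied to the segment estimate. -/
theorem lintegral_norm_translate_sub_rpow_le (hp : 1 < p) {φ : Space N → ℝ}
    (hφ : ContDiff ℝ 1 φ) (h : Space N) :
    ∫⁻ x, ENNReal.ofReal (‖φ (x + h) - φ x‖ ^ p) ≤
      ENNReal.ofReal (‖h‖ ^ p) * ∫⁻ x, ENNReal.ofReal (‖gradient φ x‖ ^ p) := by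
  have hp0 : 0 < p := by linarith
  have hcg : Continuous (gradient φ) :=
    (LinearIsometryEquiv.continuous _).comp (hφ.continuous_fderiv one_ne_zero)
  have hc : Continuous fun z : Space N × ℝ =>
      ENNReal.ofReal (‖gradient φ (z.1 + z.2 • h)‖ ^ p) :=
    continuous_ofReal_norm_rpow hp0.le (hcg.comp (by fun_prop))
  calc ∫⁻ x, ENNReal.ofReal (‖φ (x + h) - φ x‖ ^ p)
      ≤ ∫⁻ x, ENNReal.ofReal (‖h‖ ^ p) *
        ∫⁻ t in Set.Ioc (0 : ℝ) 1, ENNReal.ofReal (‖gradient φ (x + t • h)‖ ^ p) :=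
        lintegral_mono fun x => ofReal_norm_sub_rpow_le hp hφ x h
    _ = ENNReal.ofReal (‖h‖ ^ p) * ∫⁻ t in Set.Ioc (0 : ℝ) 1,
        ∫⁻ x, ENNReal.ofReal (‖gradient φ (x + t • h)‖ ^ p) := by
        rw [lintegral_const_mul' _ _ ENNReal.ofReal_ne_top, lintegral_lintegral_swap]
        exact hc.aemeasurable
    _ = ENNReal.ofReal (‖h‖ ^ p) * ∫⁻ x, ENNReal.ofReal (‖gradient φ x‖ ^ p) := by
        congr 1
        have : ∀ t : ℝ, ∫⁻ x, ENNReal.ofReal (‖gradient φ (x + t • h)‖ ^ p) =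
            ∫⁻ x, ENNReal.ofReal (‖gradient φ x‖ ^ p) := fun t =>
          lintegral_add_right_eq_self (fun x => ENNReal.ofReal (‖gradient φ x‖ ^ p)) (t • h)
        simp [this]

/-- Jensen's inequality for the average; the ball about `y` lies in the ball of radius `2 * r` about
`x`, which allows integrating over displacements independent of `y`. -/
theorem ofReal_norm_sub_average_rpow_le (hp : 1 < p) {φ : Space N → ℝ} (hφ : Continuous φ)
    {r : ℝ} (hr : 0 < r) {x y : Space N} (hxy : dist y x < r) :
    ENNReal.ofReal (‖φ x - ⨍ z in Metric.ball y r, φ z‖ ^ p) ≤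
      (∫⁻ h in Metric.ball (0 : Space N) (2 * r), ENNReal.ofReal (‖φ (x + h) - φ x‖ ^ p))
        / volume (Metric.ball (0 : Space N) r) := by
  have hp0 : 0 < p := by linarith
  have hrp : Continuous fun t : ℝ => t ^ p := continuous_id.rpow_const fun _ => Or.inr hp0.le
  have hv0 : volume (Metric.ball y r) ≠ 0 := (Metric.measure_ball_pos volume y hr).ne'
  have hvt : volume (Metric.ball y r) ≠ ⊤ := measure_ball_lt_top.ne
  have hii : ∀ f : Space N → ℝ, Continuous f → IntegrableOn f (Metric.ball y r) volume :=
    fun f hf => (hf.continuousOn.integrableOn_compact (isCompact_closedBall y r)).mono_set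
      Metric.ball_subset_closedBall
  have hsub : Continuous fun z => φ z - φ x := hφ.sub continuous_const
  have hJ := (convexOn_norm_rpow (E := ℝ) hp.le).map_set_average_le
    (μ := volume) (t := Metric.ball y r) (f := fun z => φ z - φ x)
    (hrp.comp continuous_norm).continuousOn isClosed_univ hv0 hvt (by simp) (hii _ hsub)
    (hii _ (hrp.comp hsub.norm))
  have hav : ⨍ z in Metric.ball y r, (φ z - φ x) = (⨍ z in Metric.ball y r, φ z) - φ x := by
    have hv : volume.real (Metric.ball y r) ≠ 0 := by
      rw [measureReal_def]
      exact (ENNReal.toReal_pos hv0 hvt).ne'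
    rw [setAverage_eq, setAverage_eq, integral_sub (hii _ hφ) (hii _ continuous_const),
      setIntegral_const, smul_sub, smul_smul, inv_mul_cancel₀ hv, one_smul]
  rw [hav, norm_sub_rev] at hJ
  refine (ENNReal.ofReal_le_ofReal hJ).trans ?_
  have hig : IntegrableOn (fun z => ‖φ z - φ x‖ ^ p) (Metric.ball y r) volume :=
    hii _ (hrp.comp hsub.norm)
  rw [ofReal_setAverage hig (Filter.Eventually.of_forall fun t => by
      simp only [Pi.zero_apply]
      positivity), Measure.addHaar_ball_center]
  refine ENNReal.div_le_div_right ?_ _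
  have hball : Metric.ball y r ⊆ Metric.ball x (2 * r) := fun z hz => by
    rw [Metric.mem_ball] at hz ⊢
    linarith [dist_triangle z y x]
  refine (lintegral_mono_set hball).trans_eq ?_
  rw [← lintegral_indicator Metric.isOpen_ball.measurableSet,
    ← lintegral_indicator Metric.isOpen_ball.measurableSet,
    ← lintegral_add_left_eq_self _ x]
  congr 1
  funext h
  by_cases hh : h ∈ Metric.ball (0 : Space N) (2 * r)
  · rw [Set.indicator_of_mem hh, Set.indicator_of_mem]
    simpa using hh
  · rw [Set.indicator_of_notMem hh, Set.indicator_of_notMem]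
    simpa using hh

/-- The factor `2 ^ N` is the ratio of the volumes of balls of radii `2 * r` and `r`, and `(2 * r) ^
p` bounds the displacements. The choice of centres `P` does not enter the constant. -/
theorem lintegral_norm_sub_average_rpow_le (hp : 1 < p) {φ : Space N → ℝ}
    (hφ : ContDiff ℝ 1 φ) {r : ℝ} (hr : 0 < r) (hΩ : MeasurableSet Ω) {P : Space N → Space N}
    (hP : ∀ x ∈ Ω, dist (P x) x < r) :
    ∫⁻ x in Ω, ENNReal.ofReal (‖φ x - ⨍ z in Metric.ball (P x) r, φ z‖ ^ p) ≤
      ENNReal.ofReal (2 ^ N * (2 * r) ^ p) * ∫⁻ x, ENNReal.ofReal (‖gradient φ x‖ ^ p) := by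
  have hp0 : 0 < p := by linarith
  set V := volume (Metric.ball (0 : Space N) r) with hV
  have hv0 : V ≠ 0 := (Metric.measure_ball_pos volume _ hr).ne'
  have hvt : V ≠ ⊤ := measure_ball_lt_top.ne
  have hc : Continuous fun z : Space N × Space N =>
      ENNReal.ofReal (‖φ (z.1 + z.2) - φ z.1‖ ^ p) :=
    continuous_ofReal_norm_rpow hp0.le
      ((hφ.continuous.comp (continuous_fst.add continuous_snd)).sub
      (hφ.continuous.comp continuous_fst))
  set I := ∫⁻ x, ENNReal.ofReal (‖gradient φ x‖ ^ p) with hI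
  calc ∫⁻ x in Ω, ENNReal.ofReal (‖φ x - ⨍ z in Metric.ball (P x) r, φ z‖ ^ p)
      ≤ ∫⁻ x in Ω, (∫⁻ h in Metric.ball (0 : Space N) (2 * r),
        ENNReal.ofReal (‖φ (x + h) - φ x‖ ^ p)) / V :=
        setLIntegral_mono' hΩ fun x hx =>
          ofReal_norm_sub_average_rpow_le hp hφ.continuous hr (hP x hx)
    _ ≤ ∫⁻ x, (∫⁻ h in Metric.ball (0 : Space N) (2 * r),
        ENNReal.ofReal (‖φ (x + h) - φ x‖ ^ p)) / V := setLIntegral_le_lintegral _ _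
    _ = (∫⁻ h in Metric.ball (0 : Space N) (2 * r), ∫⁻ x,
        ENNReal.ofReal (‖φ (x + h) - φ x‖ ^ p)) / V := by
        simp only [div_eq_mul_inv]
        rw [lintegral_mul_const' _ _ (ENNReal.inv_ne_top.2 hv0), lintegral_lintegral_swap]
        exact hc.aemeasurable
    _ ≤ (∫⁻ h in Metric.ball (0 : Space N) (2 * r), ENNReal.ofReal ((2 * r) ^ p) * I) / V := by
        refine ENNReal.div_le_div_right (setLIntegral_mono' Metric.isOpen_ball.measurableSet
          fun h hh => (lintegral_norm_translate_sub_rpow_le hp hφ h).trans ?_) _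
        have : ‖h‖ ≤ 2 * r := by simpa using (Metric.mem_ball.1 hh).le
        gcongr
    _ = ENNReal.ofReal (2 ^ N * (2 * r) ^ p) * I := by
        rw [setLIntegral_const, Measure.addHaar_ball_mul_of_pos _ _ two_pos, ← hV,
          ENNReal.ofReal_mul (by positivity), finrank_euclideanSpace_fin, div_eq_mul_inv]
        have hVV : V * V⁻¹ = 1 := ENNReal.mul_inv_cancel hv0 hvt
        calc ENNReal.ofReal ((2 * r) ^ p) * I * (ENNReal.ofReal (2 ^ N) * V) * V⁻¹
            = ENNReal.ofReal (2 ^ N) * ENNReal.ofReal ((2 * r) ^ p) * I * (V * V⁻¹) := by ring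
          _ = _ := by rw [hVV, mul_one]

/-- Finitely many balls centred in a dense sequence cover the compact closure of `Ω`; `P` sends a
point to a nearest centre among an initial stretch of the sequence containing these. -/
theorem exists_simpleFunc_dist_lt (hΩb : Bornology.IsBounded Ω) {r : ℝ} (hr : 0 < r) :
    ∃ P : SimpleFunc (Space N) (Space N), ∀ x ∈ Ω, dist (P x) x < r := by
  let e : ℕ → Space N := TopologicalSpace.denseSeq (Space N)
  have hcov : closure Ω ⊆ ⋃ k, Metric.ball (e k) r := fun x _ => by
    obtain ⟨k, hk⟩ := (TopologicalSpace.denseRange_denseSeq (Space N)).exists_dist_lt x hr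
    exact Set.mem_iUnion.2 ⟨k, hk⟩
  obtain ⟨t, ht⟩ := hΩb.isCompact_closure.elim_finite_subcover _
    (fun k => Metric.isOpen_ball) hcov
  refine ⟨SimpleFunc.nearestPt e (t.sup id), fun x hx => ?_⟩
  obtain ⟨k, hk, hxk⟩ := Set.mem_iUnion₂.1 (ht (subset_closure hx))
  have h1 := SimpleFunc.edist_nearestPt_le e x (Finset.le_sup (f := id) hk)
  rw [edist_dist, edist_dist, ENNReal.ofReal_le_ofReal_iff dist_nonneg] at h1
  exact h1.trans_lt (by rwa [dist_comm])

variable [hp : Fact (1 < p)]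

/-- A finite rank operator approximating the identity on `W_0^{1,p}(Ω)`. -/
theorem exists_isCompactOperator_norm_sub_le (hΩ : MeasurableSet Ω)
    (hΩb : Bornology.IsBounded Ω) {r : ℝ} (hr : 0 < r) :
    ∃ S : LpOn Ω p ℝ →L[ℝ] LpOn Ω p ℝ, IsCompactOperator S ∧
      ∀ u : sobolevZero Ω p, ‖fn u - S (fn u)‖ ^ p ≤ 2 ^ N * (2 * r) ^ p * ‖grad u‖ ^ p := by
  have hp0 : 0 < p := by linarith [hp.out]
  obtain ⟨P, hP⟩ := exists_simpleFunc_dist_lt hΩb hr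
  have hfin : IsFiniteMeasure ((volume : Measure (Space N)).restrict Ω) :=
    ⟨by simpa using hΩb.measure_lt_top⟩
  set V := volume.real (Metric.ball (0 : Space N) r) with hV
  have hl : ∀ y : Space N, ∃ l : LpOn Ω p ℝ →L[ℝ] ℝ, ∀ g, l g = ∫ x in Ω,
      inner ℝ ((Metric.ball y r).indicator (fun _ => V⁻¹) x) (g x) := fun y =>
    exists_clm_eq_integral_inner (memLp_indicator_const _ Metric.isOpen_ball.measurableSet _
      (Or.inr (measure_ne_top _ _)))
  choose l hl using hl
  let χ : Space N → LpOn Ω p ℝ := fun y =>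
    indicatorConstLp (ENNReal.ofReal p) (P.measurableSet_fiber y) (measure_ne_top _ _) 1
  -- At `x` the operator takes the average over the ball about `P x`. As `P` has finite range, `S`
  -- has finite rank.
  let S : LpOn Ω p ℝ →L[ℝ] LpOn Ω p ℝ := ∑ y ∈ P.range, (l y).smulRight (χ y)
  have hS : ∀ g, S g = ∑ y ∈ P.range, l y g • χ y := fun g => by simp [S]
  have hSc : IsCompactOperator S := by
    have : S ∈ compactOperator (RingHom.id ℝ) (LpOn Ω p ℝ) (LpOn Ω p ℝ) := by
      refine Submodule.sum_mem _ fun y _ => ?_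
      have h1 : IsCompactOperator (l y) := isCompactOperator_of_locallyCompactSpace_dom (l y)
      exact h1.clm_comp (ContinuousLinearMap.toSpanSingleton ℝ (χ y))
    exact this
  have hSx : ∀ g, S g =ᵐ[volume.restrict Ω] fun x => l (P x) g := by
    intro g
    have h1 : ∀ᵐ x ∂(volume.restrict Ω), ∀ y ∈ P.range,
        (l y g • χ y) x = l y g * (P ⁻¹' {y}).indicator (fun _ => (1 : ℝ)) x := by
      refine (ae_ball_iff P.range.countable_toSet).2 fun y _ => ?_
      filter_upwards [Lp.coeFn_smul (l y g) (χ y), indicatorConstLp_coeFn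
        (p := ENNReal.ofReal p) (hs := P.measurableSet_fiber y)
        (hμs := measure_ne_top (volume.restrict Ω) _) (c := (1 : ℝ))] with x h2 h3
      rw [h2, Pi.smul_apply, h3, smul_eq_mul]
    filter_upwards [h1, Lp.coeFn_finsetSum P.range fun y => l y g • χ y] with x h2 h3
    rw [hS, h3, Finset.sum_apply, Finset.sum_congr rfl h2,
      Finset.sum_eq_single_of_mem (P x) (P.mem_range_self x)]
    · simp
    · intro y _ hy
      rw [Set.indicator_of_notMem, mul_zero]
      exact fun h => hy h.symm
  refine ⟨S, hSc, fun u => ?_⟩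
  have hrp : Continuous fun t : ℝ => t ^ p := continuous_id.rpow_const fun _ => Or.inr hp0.le
  refine sobolevZero_induction (P := fun w => ‖w.1 - S w.1‖ ^ p
    ≤ 2 ^ N * (2 * r) ^ p * ‖w.2‖ ^ p) (isClosed_le ?_ ?_) ?_ u
  · exact hrp.comp (continuous_fst.sub (S.continuous.comp continuous_fst)).norm
  · exact continuous_const.mul (hrp.comp continuous_snd.norm)
  intro φ w hφ h1 h2
  have hφ1 : ContDiff ℝ 1 φ := hφ.smooth.of_le (by simp)
  -- The functional `l y` integrates over `Ω` only, but divides by the volume of the full ball; for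
  -- a test function, zero off `Ω`, this is the true average.
  have hl' : ∀ y, l y w.1 = ⨍ z in Metric.ball y r, φ z := by
    intro y
    have h3 : ∫ x in Ω, inner ℝ ((Metric.ball y r).indicator (fun _ => V⁻¹) x) (w.1 x) =
        ∫ x in Ω, (Metric.ball y r).indicator (fun x => V⁻¹ * φ x) x := by
      apply integral_congr_ae
      filter_upwards [h1] with x hx
      rw [hx]
      by_cases hxy : x ∈ Metric.ball y r <;> simp [hxy, mul_comm]
    have h4 : ∫ x in Ω, (Metric.ball y r).indicator (fun x => V⁻¹ * φ x) x =
        ∫ x, (Metric.ball y r).indicator (fun x => V⁻¹ * φ x) x := by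
      refine setIntegral_eq_integral_of_forall_compl_eq_zero fun x hx => ?_
      have h0 : φ x = 0 := image_eq_zero_of_notMem_tsupport fun h => hx (hφ.support_subset h)
      by_cases hxy : x ∈ Metric.ball y r <;> simp [hxy, h0]
    rw [hl, h3, h4, integral_indicator Metric.isOpen_ball.measurableSet, integral_const_mul,
      setAverage_eq, hV, measureReal_def, measureReal_def, Measure.addHaar_ball_center volume y r, smul_eq_mul]
  have hgrad : ∫⁻ x, ENNReal.ofReal (‖gradient φ x‖ ^ p) = ENNReal.ofReal (‖w.2‖ ^ p) := by
    rw [norm_rpow_eq_integral, ofReal_integral_eq_lintegral_ofReal (Lp.integrable_norm_rpow w.2)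
      (Filter.Eventually.of_forall fun x => by simp only [Pi.zero_apply]; positivity)]
    symm
    calc ∫⁻ x in Ω, ENNReal.ofReal (‖w.2 x‖ ^ p)
        = ∫⁻ x in Ω, ENNReal.ofReal (‖gradient φ x‖ ^ p) := by
          apply lintegral_congr_ae
          filter_upwards [h2] with x hx
          rw [hx]
      _ = ∫⁻ x, ENNReal.ofReal (‖gradient φ x‖ ^ p) := by
          refine setLIntegral_eq_of_support_subset fun x hx => ?_
          by_contra hxΩ
          have h0 : fderiv ℝ φ x = 0 := by
            refine image_eq_zero_of_notMem_tsupport fun h => hxΩ (hφ.support_subset ?_)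
            exact tsupport_fderiv_subset ℝ h
          simp [norm_gradient, h0, hp0.ne'] at hx
  have hmain := lintegral_norm_sub_average_rpow_le hp.out hφ1 hr hΩ hP
  rw [hgrad, ← ENNReal.ofReal_mul (by positivity)] at hmain
  have hL : ENNReal.ofReal (‖w.1 - S w.1‖ ^ p) =
      ∫⁻ x in Ω, ENNReal.ofReal (‖φ x - ⨍ z in Metric.ball (P x) r, φ z‖ ^ p) := by
    rw [norm_sub_rpow_eq_integral, ofReal_integral_eq_lintegral_ofReal
      (integrable_norm_sub_rpow _ _)
      (Filter.Eventually.of_forall fun x => by simp only [Pi.zero_apply]; positivity)]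
    apply lintegral_congr_ae
    filter_upwards [h1, hSx w.1] with x e1 e2
    rw [e1, e2, hl']
  rw [← hL] at hmain
  exact (ENNReal.ofReal_le_ofReal_iff (by positivity)).1 hmain

/-- The underlying function of an element of `W_0^{1,p}(Ω)`, as a continuous linear map. -/
noncomputable def fnL : sobolevZero Ω p →L[ℝ] LpOn Ω p ℝ :=
  (ContinuousLinearMap.fst ℝ _ _).comp (sobolevZero Ω p).subtypeL

/-- The weak gradient, as a continuous linear map. -/
noncomputable def gradL : sobolevZero Ω p →L[ℝ] LpOn Ω p (Space N) :=
  (ContinuousLinearMap.snd ℝ _ _).comp (sobolevZero Ω p).subtypeL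

/-- The **Rellich–Kondrachov theorem** for `W_0^{1,p}(Ω) ⊆ L^p(Ω)`. -/
theorem isCompactOperator_fnL (hΩ : MeasurableSet Ω) (hΩb : Bornology.IsBounded Ω) :
    IsCompactOperator (fnL : sobolevZero Ω p →L[ℝ] LpOn Ω p ℝ) := by
  have hp0 : 0 < p := by linarith [hp.out]
  -- Compact operators are closed in operator norm, so it is enough to approximate `fnL` by `S ∘
  -- fnL`.
  have hcl : IsClosed {T : sobolevZero Ω p →L[ℝ] LpOn Ω p ℝ | IsCompactOperator T} :=
    isClosed_setOfPred_isCompactOperator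
  have hmem : (fnL : sobolevZero Ω p →L[ℝ] LpOn Ω p ℝ) ∈
      closure {T : sobolevZero Ω p →L[ℝ] LpOn Ω p ℝ | IsCompactOperator T} := by
    refine (Metric.mem_closure_iff (α := sobolevZero Ω p →L[ℝ] LpOn Ω p ℝ)).2 fun ε hε => ?_
    obtain ⟨r, hr, hrε⟩ : ∃ r : ℝ, 0 < r ∧ 2 ^ N * (2 * r) ^ p ≤ (ε / 2) ^ p := by
      -- The solution of `2 ^ N * (2 * r) ^ p = (ε / 2) ^ p`.
      refine ⟨ε / 2 / 2 / (2 ^ N) ^ (1 / p), by positivity, ?_⟩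
      have h1 : 2 * (ε / 2 / 2 / ((2 : ℝ) ^ N) ^ (1 / p)) = ε / 2 / ((2 : ℝ) ^ N) ^ (1 / p) := by
        ring
      rw [h1, Real.div_rpow (by positivity) (by positivity), ← Real.rpow_mul (by positivity),
        one_div_mul_cancel hp0.ne', Real.rpow_one, mul_div_cancel₀ _ (by positivity)]
    obtain ⟨S, hS, hle⟩ := exists_isCompactOperator_norm_sub_le (p := p) hΩ hΩb hr
    refine ⟨S.comp fnL, hS.comp_clm fnL, ?_⟩
    refine lt_of_eq_of_lt (dist_eq_norm (fnL : sobolevZero Ω p →L[ℝ] LpOn Ω p ℝ) (S.comp fnL)) ?_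
    refine (ContinuousLinearMap.opNorm_le_bound _ (by positivity : 0 ≤ ε / 2) fun u => ?_).trans_lt
      (half_lt_self hε)
    have h1 : ‖fn u - S (fn u)‖ ≤ ε / 2 * ‖grad u‖ := by
      refine (Real.rpow_le_rpow_iff (norm_nonneg _) (by positivity) hp0).1 ((hle u).trans ?_)
      rw [Real.mul_rpow (by positivity) (norm_nonneg _)]
      gcongr
    refine h1.trans (mul_le_mul_of_nonneg_left ?_ (by positivity))
    exact norm_snd_le u.1
  exact hcl.closure_subset hmem

end Rellich

/-! ### Weak limits and lower semicontinuity of the energy. -/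

section LowerSemicontinuity

section Convexity

variable {E : Type*} [NormedAddCommGroup E] [InnerProductSpace ℝ E] {p : ℝ}

/-- With `s` frozen, the mixed term is linear in `ξ` and the last term constant, so only `k ≥ 0`
matters for convexity. -/
theorem density_combo_le (hp : 1 ≤ p) {k : ℝ} (hk : 0 ≤ k) (F : E) (m s : ℝ) (ξ η : E)
    {a b : ℝ} (ha : 0 ≤ a) (hb : 0 ≤ b) (hab : a + b = 1) :
    density p k F m s (a • ξ + b • η) ≤ a * density p k F m s ξ + b * density p k F m s η := by
  have h := (convexOn_norm_rpow (E := E) hp).2 (Set.mem_univ ξ) (Set.mem_univ η) ha hb hab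
  simp only [smul_eq_mul] at h
  have h1 := mul_le_mul_of_nonneg_left h hk
  have h2 : m * ‖s‖ ^ p = a * (m * ‖s‖ ^ p) + b * (m * ‖s‖ ^ p) := by
    rw [← add_mul, hab, one_mul]
  simp only [density, inner_add_right, inner_smul_right]
  linarith

theorem IsCoeff.convexOn_functional {α : Type*} [MeasurableSpace α] {μ : Measure α}
    [FiniteDimensional ℝ E] [hp : Fact (1 < p)] {k : α → ℝ} {F : α → E} {m : α → ℝ} {M : ℝ}
    (h : IsCoeff μ k F m M) (hk : ∀ x, 0 ≤ k x) (s : Lp ℝ (ENNReal.ofReal p) μ) :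
    ConvexOn ℝ Set.univ fun g : Lp E (ENNReal.ofReal p) μ => functional k F m (s, g) := by
  refine ⟨convex_univ, fun g _ g' _ a b ha hb hab => ?_⟩
  have i := (h.integrable_density (s, g)).const_mul a
  have i' := (h.integrable_density (s, g')).const_mul b
  simp only [smul_eq_mul, functional]
  rw [← integral_const_mul, ← integral_const_mul, ← integral_add i i']
  refine integral_mono_ae (h.integrable_density (s, a • g + b • g')) (i.add i') ?_
  filter_upwards [Lp.coeFn_add (a • g) (b • g'), Lp.coeFn_smul a g, Lp.coeFn_smul b g']
    with x h1 h2 h3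
  rw [h1, Pi.add_apply, h2, h3]
  exact density_combo_le hp.out.le (hk x) _ _ _ _ _ ha hb hab

end Convexity

variable {N : ℕ} {Ω : Set (Space N)} {p : ℝ} [hp : Fact (1 < p)]

/-- Bounded sequences in `W_0^{1,p}(Ω)` have a subsequence which converges strongly in `L^p(Ω)`
and along which continuous convex functionals are lower semicontinuous. -/
theorem exists_weak_limit (hΩ : MeasurableSet Ω) (hΩb : Bornology.IsBounded Ω)
    (w : ℕ → sobolevZero Ω p) {R : ℝ} (hR : ∀ k, ‖w k‖ ≤ R) :
    ∃ (u : sobolevZero Ω p) (σ : ℕ → ℕ), StrictMono σ ∧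
      Filter.Tendsto (fun k => fn (w (σ k))) Filter.atTop (nhds (fn u)) ∧
      ∀ G : sobolevZero Ω p → ℝ, Continuous G → ConvexOn ℝ Set.univ G → ∀ c : ℝ,
        (∀ᶠ k in Filter.atTop, G (w (σ k)) ≤ c) → G u ≤ c := by
  obtain ⟨K, hK, hsub⟩ :=
    (isCompactOperator_fnL (p := p) hΩ hΩb).image_closedBall_subset_compact R
  obtain ⟨f₀, -, σ, hσ, hlim⟩ := hK.tendsto_subseq
    (x := fun k => fnL (w k)) fun k => hsub ⟨w k, by simpa using hR k, rfl⟩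
  obtain ⟨v, hv, hcauchy⟩ := exists_mem_convexHull_cauchySeq
    (gradL (Ω := Ω) (p := p)).toLinearMap (fun k => w (σ k)) (R := R)
    fun k => (norm_snd_le (w (σ k)).1).trans (hR _)
  obtain ⟨g₀, hg₀⟩ := cauchySeq_tendsto_of_complete hcauchy
  -- A convex set that eventually contains the subsequence eventually contains the combinations `v
  -- n`. Applied to balls it keeps the `L^p` limit, and applied to sublevel sets it gives
  -- semicontinuity.
  have htail : ∀ C : Set (sobolevZero Ω p), Convex ℝ C →
      (∀ᶠ k in Filter.atTop, w (σ k) ∈ C) → ∀ᶠ n in Filter.atTop, v n ∈ C := by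
    intro C hC hw
    obtain ⟨n₀, hn₀⟩ := Filter.eventually_atTop.1 hw
    filter_upwards [Filter.eventually_ge_atTop n₀] with n hn
    refine convexHull_min ?_ hC (hv n)
    rintro _ ⟨k, hk, rfl⟩
    exact hn₀ k (hn.trans hk)
  have hfv : Filter.Tendsto (fun n => fn (v n)) Filter.atTop (nhds f₀) := by
    rw [Metric.tendsto_nhds]
    intro ε hε
    exact htail _ ((convex_ball f₀ ε).linear_preimage (fnL (Ω := Ω) (p := p)).toLinearMap)
      (Metric.tendsto_nhds.1 hlim ε hε)
  have hpair : Filter.Tendsto (fun n => (v n).1) Filter.atTop (nhds (f₀, g₀)) :=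
    hfv.prodMk_nhds hg₀
  have hmem : (f₀, g₀) ∈ (sobolevZero Ω p : Set (LpOn Ω p ℝ × LpOn Ω p (Space N))) :=
    isClosed_sobolevZero.mem_of_tendsto hpair (Filter.Eventually.of_forall fun n => (v n).2)
  refine ⟨⟨(f₀, g₀), hmem⟩, σ, hσ, hlim, fun G hG hGc c hc => ?_⟩
  have hvu : Filter.Tendsto v Filter.atTop (nhds ⟨(f₀, g₀), hmem⟩) :=
    tendsto_subtype_rng.2 hpair
  refine le_of_tendsto ((hG.tendsto _).comp hvu) ?_
  filter_upwards [htail {x ∈ Set.univ | G x ≤ c} (hGc.convex_le c)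
    (hc.mono fun k hk => ⟨Set.mem_univ _, hk⟩)] with n hn
  exact hn.2

/-- The exterior of a ball. -/
def exterior (N : ℕ) (ρ : ℝ) : Set (Space N) := {x | ρ < ‖x‖}

theorem measurableSet_exterior (ρ : ℝ) : MeasurableSet (exterior N ρ) :=
  (isOpen_lt continuous_const continuous_norm).measurableSet

/-- The `hardyDensity`, cut off near the origin, integrated over `Ω`. -/
noncomputable def cutHardy (a ρ : ℝ) (w : LpOn Ω p ℝ × LpOn Ω p (Space N)) : ℝ :=
  functional ((exterior N ρ).indicator fun _ => (1 : ℝ))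
    ((exterior N ρ).indicator fun x => a ^ (p - 1) • eulerField p ‖x‖ x)
    ((exterior N ρ).indicator fun x => (p - 1) * (a ^ p * ‖x‖ ^ (-p))) w

/-- Away from the ball of radius `ρ` the singular coefficients are bounded, so `cutHardy` is
continuous in the `L^p` norms; the constant is the sum of the three bounds. -/
theorem isCoeff_cutHardy {a ρ : ℝ} (ha : 0 ≤ a) (hρ : 0 < ρ) (μ : Measure (Space N)) :
    IsCoeff μ ((exterior N ρ).indicator fun _ => (1 : ℝ))
    ((exterior N ρ).indicator fun x => a ^ (p - 1) • eulerField p ‖x‖ x)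
    ((exterior N ρ).indicator fun x => (p - 1) * (a ^ p * ‖x‖ ^ (-p)))
    (1 + a ^ (p - 1) * (p * ρ⁻¹ ^ (p - 1)) + (p - 1) * (a ^ p * ρ ^ (-p))) := by
  have hp0 : 0 < p := by linarith [hp.out]
  have hp1 : 0 ≤ p - 1 := by linarith [hp.out]
  have b1 : 0 ≤ a ^ (p - 1) * (p * ρ⁻¹ ^ (p - 1)) := by positivity
  have b2 : 0 ≤ (p - 1) * (a ^ p * ρ ^ (-p)) := by positivity
  have hA := measurableSet_exterior (N := N) ρ
  have hnm : Measurable fun x : Space N => ‖x‖ ^ (-p) := measurable_norm.pow_const _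
  refine ⟨aestronglyMeasurable_const.indicator hA, ?_, ?_, fun x => ?_, fun x => ?_, fun x => ?_⟩
  · refine AEStronglyMeasurable.indicator ?_ hA
    exact (((hnm.const_mul p).smul measurable_id).const_smul (a ^ (p - 1))).aestronglyMeasurable
  · refine AEStronglyMeasurable.indicator ?_ hA
    exact ((hnm.const_mul _).const_mul _).aestronglyMeasurable
  · by_cases hx : x ∈ exterior N ρ
    · rw [Set.indicator_of_mem hx, abs_one]
      linarith
    · rw [Set.indicator_of_notMem hx, abs_zero]
      linarith
  · by_cases hx : x ∈ exterior N ρ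
    · have hx' : ρ < ‖x‖ := hx
      have h1 : a ^ (p - 1) * ‖eulerField p ‖x‖ x‖ ≤ a ^ (p - 1) * (p * ρ⁻¹ ^ (p - 1)) := by
        have := norm_eulerField_le hp0 (hρ.trans hx') le_rfl
        refine mul_le_mul_of_nonneg_left (this.trans ?_) (by positivity)
        gcongr
      rw [Set.indicator_of_mem hx, norm_smul, Real.norm_of_nonneg (by positivity)]
      linarith
    · rw [Set.indicator_of_notMem hx, norm_zero]
      linarith
  · by_cases hx : x ∈ exterior N ρ
    · have hx' : ρ < ‖x‖ := hx
      have h1 : (p - 1) * (a ^ p * ‖x‖ ^ (-p)) ≤ (p - 1) * (a ^ p * ρ ^ (-p)) := by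
        have := Real.rpow_le_rpow_of_nonpos hρ hx'.le (by linarith : -p ≤ 0)
        gcongr
      rw [Set.indicator_of_mem hx, abs_of_nonneg (by positivity)]
      linarith
    · rw [Set.indicator_of_notMem hx, abs_zero]
      linarith

theorem cutHardy_eq (a ρ : ℝ) (u : sobolevZero Ω p) : cutHardy a ρ u.1 =
    ∫ x in Ω, (exterior N ρ).indicator (fun x => hardyDensity p a x (fn u x) (grad u x)) x := by
  rw [cutHardy, functional]
  congr 1
  funext x
  by_cases hx : x ∈ exterior N ρ
  · simp only [Set.indicator_of_mem hx, hardyDensity, fn, grad]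
  · simp [Set.indicator_of_notMem hx, density]

/-- Nonnegativity of the density is what allows discarding the part near the origin. -/
theorem cutHardy_le (hpN : p < N) (ρ : ℝ) (u : sobolevZero Ω p) :
    cutHardy ((N - p) / p) ρ u.1 ≤
      ∫ x in Ω, hardyDensity p ((N - p) / p) x (fn u x) (grad u x) := by
  have ha : 0 ≤ (N - p) / p := div_nonneg (by linarith) (by linarith [hp.out])
  have hi := (integral_hardyDensity hpN u).1
  rw [cutHardy_eq]
  exact integral_mono (hi.indicator (measurableSet_exterior ρ)) hi fun x =>
    Set.indicator_le_self' (fun _ _ => hardyDensity_nonneg ha _ _ _) x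

theorem tendsto_cutHardy (hpN : p < N) (u : sobolevZero Ω p) :
    Filter.Tendsto (fun n : ℕ => cutHardy ((N - p) / p) (1 / ((n : ℝ) + 1)) u.1) Filter.atTop
      (nhds (∫ x in Ω, hardyDensity p ((N - p) / p) x (fn u x) (grad u x))) := by
  have hN : 0 < N := by
    have : (0 : ℝ) < N := by linarith [hp.out]
    exact_mod_cast this
  have hae := ae_ne_zero hN (volume.restrict Ω) Measure.absolutelyContinuous_restrict
  have hi := (integral_hardyDensity hpN u).1
  simp only [cutHardy_eq]
  refine tendsto_integral_of_dominated_convergence _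
    (fun n => (hi.indicator (measurableSet_exterior _)).aestronglyMeasurable) hi.norm
    (fun n => Filter.Eventually.of_forall fun x => norm_indicator_le_norm_self _ x) ?_
  filter_upwards [hae] with x hx
  refine tendsto_const_nhds.congr' ?_
  filter_upwards [(tendsto_one_div_add_atTop_nhds_zero_nat (𝕜 := ℝ)).eventually
    (gt_mem_nhds (norm_pos_iff.2 hx))] with n hn
  rw [Set.indicator_of_mem (show x ∈ exterior N (1 / ((n : ℝ) + 1)) from hn)]

/-- `p` times the energy functional. -/
noncomputable def energy (β : ℝ) (f : StrongDual ℝ (sobolevZero Ω p)) (u : sobolevZero Ω p) : ℝ :=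
  ‖grad u‖ ^ p - β * (∫ x in Ω, ‖‖x‖⁻¹ * fn u x‖ ^ p) - p * f u

/-- Replacing the Hardy integral by its deficit removes the negative term: both coefficients are
nonnegative when `0 ≤ β ≤ ((N - p) / p) ^ p`. -/
theorem energy_eq (hpN : p < N) (β : ℝ) (f : StrongDual ℝ (sobolevZero Ω p))
    (u : sobolevZero Ω p) : energy β f u =
      (1 - β / ((N - p) / p) ^ p) * ‖grad u‖ ^ p + β / ((N - p) / p) ^ p *
        (∫ x in Ω, hardyDensity p ((N - p) / p) x (fn u x) (grad u x)) - p * f u := by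
  have hp0 : 0 < p := by linarith [hp.out]
  have ha : 0 < ((N - p) / p) ^ p := Real.rpow_pos_of_pos (div_pos (by linarith) hp0) p
  rw [(integral_hardyDensity hpN u).2, energy]
  field_simp
  ring

/-- For each cut-off `ρ`, the function slot of `cutHardy` is frozen at the limit `u`, which makes
the functional `G` convex. Strong `L^p` convergence makes the cost of freezing small along the
sequence. -/
theorem energy_le_of_weak_limit (hpN : p < N) {β : ℝ} (hβ : 0 ≤ β)
    (hβH : β ≤ ((N - p) / p) ^ p) (f : StrongDual ℝ (sobolevZero Ω p))
    {w : ℕ → sobolevZero Ω p} {u : sobolevZero Ω p} {R c : ℝ} (hR : ∀ k, ‖w k‖ ≤ R)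
    (hfn : Filter.Tendsto (fun k => fn (w k)) Filter.atTop (nhds (fn u)))
    (hlsc : ∀ G : sobolevZero Ω p → ℝ, Continuous G → ConvexOn ℝ Set.univ G → ∀ c : ℝ,
        (∀ᶠ k in Filter.atTop, G (w k) ≤ c) → G u ≤ c)
    (hc : ∀ ε : ℝ, 0 < ε → ∀ᶠ k in Filter.atTop, energy β f (w k) ≤ c + ε) :
    energy β f u ≤ c := by
  have hp0 : 0 < p := by linarith [hp.out]
  set a : ℝ := (N - p) / p with ha_def
  have ha : 0 < a := div_pos (by linarith) hp0
  have hap : 0 < a ^ p := by positivity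
  set θ : ℝ := β / a ^ p with hθ
  have hθ0 : 0 ≤ θ := by positivity
  have hθ1 : θ ≤ 1 := (div_le_one hap).2 hβH
  have hrp : Continuous fun t : ℝ => t ^ p := continuous_id.rpow_const fun _ => Or.inr hp0.le
  have hR0 : 0 ≤ R := (norm_nonneg _).trans (hR 0)
  have hcut : ∀ ρ : ℝ, 0 < ρ →
      (1 - θ) * ‖grad u‖ ^ p + θ * cutHardy a ρ u.1 - p * f u ≤ c := by
    intro ρ hρ
    have hco := isCoeff_cutHardy (p := p) ha.le hρ (volume.restrict Ω)
    let G : sobolevZero Ω p → ℝ := fun v =>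
      (1 - θ) * ‖grad v‖ ^ p + θ * cutHardy a ρ (fn u, grad v) - p * f v
    have hGc : Continuous G := by
      refine ((continuous_const.mul (hrp.comp gradL.continuous.norm)).add
        (continuous_const.mul ?_)).sub (continuous_const.mul f.continuous)
      exact hco.continuous_functional.comp (continuous_const.prodMk gradL.continuous)
    have hGconv : ConvexOn ℝ Set.univ G := by
      have h1 : ConvexOn ℝ Set.univ fun v : sobolevZero Ω p => ‖grad v‖ ^ p := by
        refine ⟨convex_univ, fun x _ y _ s t hs ht hst => ?_⟩
        have h2 : ‖s • grad x + t • grad y‖ ≤ s * ‖grad x‖ + t * ‖grad y‖ := by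
          refine (norm_add_le _ _).trans_eq ?_
          rw [norm_smul, norm_smul, Real.norm_of_nonneg hs, Real.norm_of_nonneg ht]
        exact (Real.rpow_le_rpow (norm_nonneg (s • grad x + t • grad y)) h2 hp0.le).trans
          ((convexOn_rpow hp.out.le).2 (norm_nonneg _) (norm_nonneg _) hs ht hst)
      have h2 : ConvexOn ℝ Set.univ fun v : sobolevZero Ω p => cutHardy a ρ (fn u, grad v) :=
        (hco.convexOn_functional (fun x => Set.indicator_nonneg (fun _ _ => zero_le_one) x)
          (fn u)).comp_linearMap (gradL (Ω := Ω) (p := p)).toLinearMap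
      have h3 : ConvexOn ℝ Set.univ fun v : sobolevZero Ω p => (-p) * f v :=
        (((-p) • f).toLinearMap.convexOn convex_univ).congr fun x _ => by simp
      refine (((h1.smul (sub_nonneg.2 hθ1)).add (h2.smul hθ0)).add h3).congr fun v _ => ?_
      simp [G]
      ring
    refine le_of_forall_pos_le_add fun ε hε => hlsc G hGc hGconv (c + ε) ?_
    -- The denominator exceeds the total mass `‖u‖^p + 3 R^p` in the estimate, so this part of the
    -- freezing error is at most `ε / 4`; the part with `C` tends to zero.
    obtain ⟨C, hC, hdiff⟩ := hco.exists_abs_functional_sub_le (p := p)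
      (by positivity : 0 < ε / 4 / (4 * R ^ p + ‖fn u‖ ^ p + 1))
    have hsmall : Filter.Tendsto (fun k => C * ‖fn (w k) - fn u‖ ^ p) Filter.atTop (nhds 0) := by
      have h1 := (tendsto_iff_norm_sub_tendsto_zero.1 hfn).rpow_const (p := p) (Or.inr hp0.le)
      simpa [hp0.ne'] using h1.const_mul C
    filter_upwards [hc (ε / 2) (half_pos hε),
      hsmall.eventually (gt_mem_nhds (by positivity : 0 < ε / 4))] with k hk hk'
    have h1 := hdiff (fn u, grad (w k)) (w k).1
    have h2 : ‖fn u - fn (w k)‖ ^ p = ‖fn (w k) - fn u‖ ^ p := by rw [norm_sub_rev]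
    have h3 : ‖(w k).1.1‖ ^ p ≤ R ^ p :=
      Real.rpow_le_rpow (norm_nonneg _) ((norm_fst_le (w k).1).trans (hR k)) hp0.le
    have h4 : ‖grad (w k)‖ ^ p ≤ R ^ p :=
      Real.rpow_le_rpow (norm_nonneg _) ((norm_snd_le (w k).1).trans (hR k)) hp0.le
    have h5 : ε / 4 / (4 * R ^ p + ‖fn u‖ ^ p + 1) * (‖fn u‖ ^ p + ‖grad (w k)‖ ^ p +
        (‖(w k).1.1‖ ^ p + ‖grad (w k)‖ ^ p)) ≤ ε / 4 := by
      rw [div_mul_eq_mul_div, div_le_iff₀ (by positivity)]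
      have : 0 ≤ R ^ p := by positivity
      refine mul_le_mul_of_nonneg_left ?_ (by positivity)
      linarith
    have h6 : C * (‖fn u - fn (w k)‖ ^ p + ‖grad (w k) - grad (w k)‖ ^ p) < ε / 4 := by
      rw [sub_self, norm_zero, Real.zero_rpow hp0.ne', add_zero, h2]
      exact hk'
    have h7 : cutHardy a ρ (fn u, grad (w k)) - cutHardy a ρ (w k).1 ≤ ε / 2 := by
      refine (le_abs_self _).trans (h1.trans ?_)
      have : ε / 4 + ε / 4 = ε / 2 := by ring
      rw [← this]
      exact add_le_add h5 h6.le
    have h8 := cutHardy_le hpN ρ (w k)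
    rw [energy_eq hpN] at hk
    have h9 : cutHardy a ρ (fn u, grad (w k)) ≤
        (∫ x in Ω, hardyDensity p a x (fn (w k) x) (grad (w k) x)) + ε / 2 := by linarith
    have h10 := mul_le_mul_of_nonneg_left h9 hθ0
    have h11 : θ * (ε / 2) ≤ ε / 2 := mul_le_of_le_one_left (by positivity) hθ1
    simp only [G]
    linarith
  -- The bound holds for every `ρ > 0`; letting `ρ → 0` recovers the full deficit of `u`.
  rw [energy_eq hpN]
  refine le_of_tendsto (((tendsto_cutHardy hpN u).const_mul θ).const_add
    ((1 - θ) * ‖grad u‖ ^ p) |>.sub_const (p * f u))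
    (Filter.Eventually.of_forall fun n => hcut _ (by positivity))

end LowerSemicontinuity

/-! ### Existence of a minimizer, the Euler–Lagrange equation and the norm bound. -/

section Minimization

/-- A superlinear power dominates every affine function. -/
theorem exists_le_mul_rpow_sub {p : ℝ} (hp : 1 < p) {θ K : ℝ} (hθ : 0 < θ) (hK : 0 ≤ K) :
    ∃ L : ℝ, ∀ t : ℝ, 0 ≤ t → t - L ≤ θ * t ^ p - K * t := by
  have hp1 : 0 < p - 1 := by linarith
  -- The threshold where `θ * T ^ (p - 1) = K + 1`: beyond it the power beats `(K + 1) * t`, and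
  -- before it the constant `(K + 1) * T` suffices.
  set T : ℝ := ((K + 1) / θ) ^ (1 / (p - 1)) with hT
  have hT0 : 0 ≤ T := by positivity
  have hTp : θ * T ^ (p - 1) = K + 1 := by
    rw [hT, ← Real.rpow_mul (by positivity), one_div_mul_cancel hp1.ne', Real.rpow_one,
      mul_div_cancel₀ _ hθ.ne']
  refine ⟨(K + 1) * T, fun t ht => ?_⟩
  rcases le_total t T with h | h
  · have h1 : 0 ≤ θ * t ^ p := by positivity
    nlinarith
  · have h1 : t ^ p = t ^ (p - 1) * t := by
      rw [← Real.rpow_add_one' ht (by linarith)]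
      ring_nf
    have h2 : K + 1 ≤ θ * t ^ (p - 1) := by
      rw [← hTp]
      gcongr
    have h3 := mul_le_mul_of_nonneg_right h2 ht
    have h4 : 0 ≤ (K + 1) * T := by positivity
    rw [h1]
    linarith

/-- Puts the potential term in the duality form for `u / |x|` and `φ / |x|`, to which the
differentiation lemma applies. -/
theorem inner_powMap_inv_norm_mul {N : ℕ} {p : ℝ} {x : Space N} (hx : x ≠ 0) (s t : ℝ) :
    inner ℝ (powMap p (‖x‖⁻¹ * s)) (‖x‖⁻¹ * t) = 1 / ‖x‖ ^ p * (|s| ^ (p - 2) * s * t) := by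
  have hx0 : 0 < ‖x‖ := norm_pos_iff.2 hx
  have h1 : 1 / ‖x‖ ^ p = ‖x‖⁻¹ ^ (p - 2) * ‖x‖⁻¹ * ‖x‖⁻¹ := by
    rw [mul_assoc, ← sq, ← Real.rpow_natCast, ← Real.rpow_add (by positivity),
      Real.inv_rpow hx0.le, one_div]
    norm_num
  rw [powMap, norm_mul, norm_inv, norm_norm, Real.mul_rpow (by positivity) (norm_nonneg s),
    h1, Real.norm_eq_abs, real_inner_eq_re_inner, RCLike.inner_apply]
  simp
  ring

variable {N : ℕ} {Ω : Set (Space N)} {p : ℝ} [hp : Fact (1 < p)]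

theorem exists_norm_le_normZero (hpN : p < N) (hΩ : MeasurableSet Ω)
    (hΩb : Bornology.IsBounded Ω) :
    ∃ C : ℝ, 0 ≤ C ∧ ∀ u : sobolevZero Ω p, ‖u‖ ≤ C * ‖grad u‖ := by
  obtain ⟨C, hC, h⟩ := exists_norm_fn_le hpN hΩ hΩb
  refine ⟨C + 1, by positivity, fun u => ?_⟩
  have h1 : ‖u‖ = max ‖fn u‖ ‖grad u‖ := rfl
  have h2 := h u
  have h3 := norm_nonneg (grad u)
  have h4 : 0 ≤ C * ‖grad u‖ := by positivity
  rw [h1]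
  exact max_le (by linarith) (by linarith)

/-- The direct method. Strictness of `β < ((N - p) / p) ^ p` leaves a positive multiple of `‖∇u‖^p`,
which dominates the linear term and gives coercivity. -/
theorem exists_energy_minimizer (hpN : p < N) (hΩ : MeasurableSet Ω)
    (hΩb : Bornology.IsBounded Ω) {β : ℝ} (hβ : 0 ≤ β) (hβH : β < ((N - p) / p) ^ p)
    (f : StrongDual ℝ (sobolevZero Ω p)) :
    ∃ u : sobolevZero Ω p, ∀ v, energy β f u ≤ energy β f v := by
  have hp0 : 0 < p := by linarith [hp.out]
  set a : ℝ := (N - p) / p with ha_def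
  have ha : 0 < a := div_pos (by linarith) hp0
  have hap : 0 < a ^ p := by positivity
  have hθ : 0 < 1 - β / a ^ p := sub_pos.2 ((div_lt_one hap).2 hβH)
  obtain ⟨C, hC, hCu⟩ := exists_norm_le_normZero (p := p) hpN hΩ hΩb
  obtain ⟨L, hL⟩ := exists_le_mul_rpow_sub hp.out hθ (by positivity : 0 ≤ p * (‖f‖ * C))
  have hco : ∀ v : sobolevZero Ω p, ‖grad v‖ - L ≤ energy β f v := by
    intro v
    refine (hL _ (norm_nonneg _)).trans ?_
    rw [energy_eq hpN]
    have h1 : f v ≤ ‖f‖ * C * ‖grad v‖ := by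
      refine (le_abs_self _).trans ((f.le_opNorm v).trans ?_)
      rw [mul_assoc]
      exact mul_le_mul_of_nonneg_left (hCu v) (norm_nonneg _)
    have h2 : 0 ≤ β / a ^ p * ∫ x in Ω, hardyDensity p a x (fn v x) (grad v x) :=
      mul_nonneg (by positivity) (integral_nonneg fun x => hardyDensity_nonneg ha.le _ _ _)
    have h3 := mul_le_mul_of_nonneg_left h1 hp0.le
    linarith
  have hbdd : BddBelow (Set.range fun v : sobolevZero Ω p => energy β f v) := by
    refine ⟨-L, ?_⟩
    rintro _ ⟨v, rfl⟩
    have := hco v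
    linarith [norm_nonneg (grad v)]
  set c := ⨅ v : sobolevZero Ω p, energy β f v with hc
  have hex : ∀ k : ℕ, ∃ v : sobolevZero Ω p, energy β f v < c + 1 / ((k : ℝ) + 1) := fun k =>
    exists_lt_of_ciInf_lt (lt_add_of_pos_right c (by positivity))
  choose w hw using hex
  have hR : ∀ k, ‖w k‖ ≤ C * (c + 1 + L) := by
    intro k
    refine (hCu (w k)).trans (mul_le_mul_of_nonneg_left ?_ hC)
    have h1 : 1 / ((k : ℝ) + 1) ≤ 1 := by
      rw [div_le_one (by positivity)]
      linarith [(Nat.cast_nonneg k : (0 : ℝ) ≤ k)]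
    linarith [hco (w k), hw k]
  obtain ⟨u, σ, hσ, hfn, hlsc⟩ := exists_weak_limit hΩ hΩb w hR
  refine ⟨u, fun v => ?_⟩
  refine (energy_le_of_weak_limit hpN hβ hβH.le f (fun k => hR (σ k)) hfn hlsc
    fun ε hε => ?_).trans (ciInf_le hbdd v)
  filter_upwards [hσ.tendsto_atTop.eventually ((tendsto_one_div_add_atTop_nhds_zero_nat
    (𝕜 := ℝ)).eventually (gt_mem_nhds hε))] with k hk
  linarith [hw (σ k)]

/-- The Euler–Lagrange equation. -/
theorem isWeakSolution_of_minimizer (hpN : p < N) {β : ℝ} {f : StrongDual ℝ (sobolevZero Ω p)}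
    {u : sobolevZero Ω p} (hu : ∀ v, energy β f u ≤ energy β f v) : IsWeakSolution β f u := by
  have hp0 : 0 < p := by linarith [hp.out]
  have hN : 0 < N := by
    have : (0 : ℝ) < N := by linarith
    exact_mod_cast this
  have hae := ae_ne_zero hN (volume.restrict Ω) Measure.absolutelyContinuous_restrict
  have ha : 0 < (N - p) / p := div_pos (by linarith) hp0
  have haN : p * ((N - p) / p) ≤ N - p := (mul_div_cancel₀ _ hp0.ne').le
  intro φ
  obtain ⟨i1, d1⟩ := integrable_inner_powMap_and_hasDerivAt hp.out (Lp.memLp (grad u))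
    (Lp.memLp (grad φ))
  obtain ⟨i2, d2⟩ := integrable_inner_powMap_and_hasDerivAt hp.out (hardy ha haN u).1
    (hardy ha haN φ).1
  have e1 : (fun x => inner ℝ (powMap p (grad u x)) (grad φ x)) =
      fun x => ‖grad u x‖ ^ (p - 2) * inner ℝ (grad u x) (grad φ x) := by
    funext x
    rw [powMap, inner_smul_left, conj_trivial]
  have e2 : (fun x => inner ℝ (powMap p (‖x‖⁻¹ * fn u x)) (‖x‖⁻¹ * fn φ x))
      =ᵐ[volume.restrict Ω]
      fun x => 1 / ‖x‖ ^ p * (|fn u x| ^ (p - 2) * fn u x * fn φ x) := by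
    filter_upwards [hae] with x hx
    exact inner_powMap_inv_norm_mul hx _ _
  refine ⟨by rwa [e1] at i1, i2.congr e2, ?_⟩
  -- Along the line `u + t φ` the energy is an explicit combination of the two differentiable
  -- integrals and an affine term.
  have hE : ∀ t : ℝ, energy β f (u + t • φ) =
      (∫ x in Ω, ‖grad u x + t • grad φ x‖ ^ p) -
        β * (∫ x in Ω, ‖‖x‖⁻¹ * fn u x + t • (‖x‖⁻¹ * fn φ x)‖ ^ p) - p * (f u + t * f φ) := by
    intro t
    have h1 : ‖grad (u + t • φ)‖ ^ p = ∫ x in Ω, ‖grad u x + t • grad φ x‖ ^ p := by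
      rw [norm_rpow_eq_integral]
      apply integral_congr_ae
      have hx : grad (u + t • φ) = grad u + t • grad φ := rfl
      rw [hx]
      filter_upwards [Lp.coeFn_add (grad u) (t • grad φ), Lp.coeFn_smul t (grad φ)] with x h1 h2
      rw [h1, Pi.add_apply, h2, Pi.smul_apply]
    have h2 : ∫ x in Ω, ‖‖x‖⁻¹ * fn (u + t • φ) x‖ ^ p =
        ∫ x in Ω, ‖‖x‖⁻¹ * fn u x + t • (‖x‖⁻¹ * fn φ x)‖ ^ p := by
      apply integral_congr_ae
      have hx : fn (u + t • φ) = fn u + t • fn φ := rfl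
      rw [hx]
      filter_upwards [Lp.coeFn_add (fn u) (t • fn φ), Lp.coeFn_smul t (fn φ)] with x h1 h2
      rw [h1, Pi.add_apply, h2, Pi.smul_apply, mul_add, smul_eq_mul, smul_eq_mul, mul_left_comm]
    rw [energy, h1, h2, map_add, map_smul, smul_eq_mul]
  have hd := (d1.sub (d2.const_mul β)).sub
    ((((hasDerivAt_id (0 : ℝ)).mul_const (f φ)).const_add (f u)).const_mul p)
  have hmin : IsLocalMin (fun t : ℝ => energy β f (u + t • φ)) 0 :=
    Filter.Eventually.of_forall fun t => by simpa using hu (u + t • φ)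
  have h0 := hmin.hasDerivAt_eq_zero (hd.congr_of_eventuallyEq
    (Filter.Eventually.of_forall fun t => hE t))
  rw [integral_congr_ae e2, e1] at h0
  have h1 : p * ((∫ x in Ω, ‖grad u x‖ ^ (p - 2) * inner ℝ (grad u x) (grad φ x)) -
      (β * (∫ x in Ω, 1 / ‖x‖ ^ p * (|fn u x| ^ (p - 2) * fn u x * fn φ x)) + f φ)) = 0 := by
    rw [← h0]
    ring
  linarith [(mul_eq_zero.1 h1).resolve_left hp0.ne']

/-- Normalising `u` by its gradient norm. The Poincaré inequality is needed twice: to make the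
supremum one of a bounded set, and to show `f u = 0` when the gradient vanishes. -/
theorem le_dualNorm_mul (hpN : p < N) (hΩ : MeasurableSet Ω) (hΩb : Bornology.IsBounded Ω)
    (f : StrongDual ℝ (sobolevZero Ω p)) (u : sobolevZero Ω p) :
    f u ≤ dualNorm f * ‖grad u‖ := by
  obtain ⟨C, hC, hCu⟩ := exists_norm_le_normZero (p := p) hpN hΩ hΩb
  have hb : ∀ v : sobolevZero Ω p, |f v| ≤ ‖f‖ * (C * ‖grad v‖) := fun v =>
    (f.le_opNorm v).trans (mul_le_mul_of_nonneg_left (hCu v) (norm_nonneg _))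
  have hbdd : BddAbove {t | ∃ v : sobolevZero Ω p, normZero v ≤ 1 ∧ t = |f v|} := by
    refine ⟨‖f‖ * (C * 1), ?_⟩
    rintro _ ⟨v, hv, rfl⟩
    refine (hb v).trans ?_
    have hv' : ‖grad v‖ ≤ 1 := hv
    gcongr
  rcases (norm_nonneg (grad u)).eq_or_lt with h | h
  · have := hb u
    rw [← h, mul_zero, mul_zero] at this
    rw [← h, mul_zero]
    exact (le_abs_self _).trans this
  · have h1 : grad (‖grad u‖⁻¹ • u) = ‖grad u‖⁻¹ • grad u := rfl
    have h2 : normZero (‖grad u‖⁻¹ • u) ≤ 1 := by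
      rw [normZero, h1, norm_smul, norm_inv, norm_norm, inv_mul_cancel₀ h.ne']
    have h3 : |f (‖grad u‖⁻¹ • u)| ≤ dualNorm f := le_csSup hbdd ⟨_, h2, rfl⟩
    rw [map_smul, smul_eq_mul] at h3
    have h4 := (le_abs_self _).trans h3
    rwa [inv_mul_le_iff₀ h, mul_comm] at h4

/-- Testing the equation with `u` itself and applying Hardy's inequality gives `(1 - β / a^p) ‖∇u‖^p
≤ ‖f‖ ‖∇u‖`; one factor `‖∇u‖` then cancels. The bound thus holds for every weak solution. -/
theorem normZero_le_of_isWeakSolution (hpN : p < N) (hΩ : MeasurableSet Ω)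
    (hΩb : Bornology.IsBounded Ω) {β : ℝ} (hβ : 0 ≤ β) (hβH : β < ((N - p) / p) ^ p)
    {f : StrongDual ℝ (sobolevZero Ω p)} {u : sobolevZero Ω p} (hu : IsWeakSolution β f u) :
    normZero u ≤ (dualNorm f / (1 - β * (p / (N - p)) ^ p)) ^ (1 / (p - 1)) := by
  have hp0 : 0 < p := by linarith [hp.out]
  have hp1 : 0 < p - 1 := by linarith [hp.out]
  have hN : 0 < N := by
    have : (0 : ℝ) < N := by linarith
    exact_mod_cast this
  have hae := ae_ne_zero hN (volume.restrict Ω) Measure.absolutelyContinuous_restrict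
  set a : ℝ := (N - p) / p with ha_def
  have ha : 0 < a := div_pos (by linarith) hp0
  have hap : 0 < a ^ p := by positivity
  have hinv : (p / (N - p)) ^ p = (a ^ p)⁻¹ := by
    rw [← Real.inv_rpow ha.le, ha_def, inv_div]
  have hθ : 0 < 1 - β * (p / (N - p)) ^ p := by
    rw [hinv, ← div_eq_mul_inv]
    exact sub_pos.2 ((div_lt_one hap).2 hβH)
  have hd0 : 0 ≤ dualNorm f := Real.sSup_nonneg (by rintro _ ⟨v, -, rfl⟩; positivity)
  obtain ⟨-, -, heq⟩ := hu u
  have h1 : ∫ x in Ω, ‖grad u x‖ ^ (p - 2) * inner ℝ (grad u x) (grad u x) = ‖grad u‖ ^ p := by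
    rw [norm_rpow_eq_integral]
    congr 1
    funext x
    rw [← inner_powMap_self hp.out, powMap, inner_smul_left, conj_trivial]
  have h2 : ∫ x in Ω, 1 / ‖x‖ ^ p * (|fn u x| ^ (p - 2) * fn u x * fn u x) =
      ∫ x in Ω, ‖‖x‖⁻¹ * fn u x‖ ^ p := by
    apply integral_congr_ae
    filter_upwards [hae] with x hx
    rw [← inner_powMap_inv_norm_mul hx, inner_powMap_self hp.out]
  rw [h1, h2] at heq
  have hH := (hardy ha (mul_div_cancel₀ _ hp0.ne').le u).2
  have h3 := le_dualNorm_mul hpN hΩ hΩb f u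
  have h4 : (1 - β * (p / (N - p)) ^ p) * ‖grad u‖ ^ p ≤ dualNorm f * ‖grad u‖ := by
    have h5 : ∫ x in Ω, ‖‖x‖⁻¹ * fn u x‖ ^ p ≤ (a ^ p)⁻¹ * ‖grad u‖ ^ p :=
      (le_inv_mul_iff₀ hap).2 hH
    have h6 := mul_le_mul_of_nonneg_left h5 hβ
    rw [hinv]
    linarith
  rw [normZero]
  rcases (norm_nonneg (grad u)).eq_or_lt with h | h
  · rw [← h]
    positivity
  · have h5 : ‖grad u‖ ^ p = ‖grad u‖ ^ (p - 1) * ‖grad u‖ := by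
      rw [← Real.rpow_add_one h.ne']
      ring_nf
    rw [h5, ← mul_assoc] at h4
    have h6 : ‖grad u‖ ^ (p - 1) ≤ dualNorm f / (1 - β * (p / (N - p)) ^ p) := by
      rw [le_div_iff₀ hθ, mul_comm]
      exact le_of_mul_le_mul_right h4 h
    have h7 := Real.rpow_le_rpow (by positivity) h6 (by positivity : 0 ≤ 1 / (p - 1))
    rwa [← Real.rpow_mul h.le, mul_one_div_cancel hp1.ne', Real.rpow_one] at h7

end Minimization

end HardyPLaplace

theorem theorem4p1 (N : ℕ) (p : ℝ) [Fact (1 < p)] (hpN : p < (N : ℝ))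
    (Ω : Set (HardyPLaplace.Space N)) (hΩ : IsOpen Ω) (hΩb : Bornology.IsBounded Ω)
    (β : ℝ) (hβ : 0 < β) (hβH : β < (((N : ℝ) - p) / p) ^ p)
    (f : StrongDual ℝ (HardyPLaplace.sobolevZero Ω p)) :
    ∃ u : HardyPLaplace.sobolevZero Ω p,
      HardyPLaplace.IsWeakSolution β f u ∧
      HardyPLaplace.normZero u ≤
        (HardyPLaplace.dualNorm f / (1 - β * (p / ((N : ℝ) - p)) ^ p)) ^ (1 / (p - 1)) := by
  obtain ⟨u, hu⟩ := HardyPLaplace.exists_energy_minimizer hpN hΩ.measurableSet hΩb hβ.le hβH f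
  have hw := HardyPLaplace.isWeakSolution_of_minimizer hpN hu
  exact ⟨u, hw, HardyPLaplace.normZero_le_of_isWeakSolution hpN hΩ.measurableSet hΩb hβ.le hβH hw⟩
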